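/- **Conventions.** Hypergraphs are finite. A hypergraph $\mathcal G$ has a finite vertex set $V(\mathcal G)$ and finitely many edges, each edge being a multiset of vertices; several edges may be equal as multisets, and they are then counted as distinct edges. Write $\alpha^t$ for $t$ copies of $\alpha$, and join multisets by commas to add their multiplicities. - $\deg_{\mathcal G}(v)$ is the total number of occurrences of $v$ among all edges, and $\mathrm{mult}_{\mathcal G}(X)$ is the number of edges equal to the multiset $X$. - For a hypergraph whose edges are coloured with $[k]=\{1,\dots,k\}$, $\mathcal G(j)$ is the spanning sub-hypergraph formed by the edges of colour $j$. - $c(\mathcal G)$ is the number of components of $\mathcal G$, i.e. of classes of vertices under being joined by a path of edges. A hypergraph is connected if it has a vertex, any two of its vertices are joined by a path of edges, and each of its edges contains a vertex. - For real $x,y$, $x\approx y$ means $\lfloor y\rfloor\le x\le\lceil y\rceil$. - $\mathcal G$ is $v$-simple if no edge contains $v$ more than once. An *$\alpha$-wing* of $\mathcal G$ is a connected sub-hypergraph $W$ with at least one edge and with $\alpha\in V(W)$, such that (a) $\alpha$ is not a cut vertex of $W$, i.e. $W$ is not the union of two sub-hypergraphs, each with at least one edge, that have no common edge and have $\alpha$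 as their only common vertex; and (b) no edge of $\mathcal G$ outside $W$ contains a vertex of $V(W)\setminus\{\alpha\}$. Let $\omega_\alpha(\mathcal G)$ be the number of $\alpha$-wings of $\mathcal G$. An *$(\alpha,n)$-detachment* of $\mathcal H=(V,E)$ is a hypergraph $\mathcal F$ obtained by replacing $\alpha$ by $n$ new vertices $\alpha_1,\dots,\alpha_n$ and replacing each edge $\{\alpha^p\}\cup U$ (with $p\ge 0$, $\alpha\notin U$) by an edge $\{\alpha_1^{p_1},\dots,\alpha_n^{p_n}\}\cup U$ with $p_1+\dots+p_n=p$; each edge keeps its colour. **Theorem.** Let $k$ and $n$ be positive integers. Let $\mathcal H=(V,E)$ be a hypergraph whose edges are coloured with $k$ colours, and let $\alpha\in V$ be such that $\mathrm{mult}_{\mathcal H}(\alpha^t,Y)=0$ for every $t>n$ and every multiset $Y$ of vertices (that is, $\alpha$ occurs at most $n$ times in every edge). Then there exists an $(\alpha,n)$-detachment $\mathcal F$ of $\mathcal H$ that is $\alpha_i$-simple for every $i\in[n]$ and satisfies all of the following. - **(F1)** For each $i\in[n]$: $\deg_{\mathcal F}(\alpha_i)\approx \dfrac{\deg_{\mathcal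 H}(\alpha)}{n}$. - **(F2)** For each $i\in[n]$ and $j\in[k]$: $\deg_{\mathcal F(j)}(\alpha_i)\approx \dfrac{\deg_{\mathcal H(j)}(\alpha)}{n}$. - **(F3)** For each set $U\subseteq\{\alpha_1,\dots,\alpha_n\}$ and each multiset $X$ of vertices in $V\setminus\{\alpha\}$: $\mathrm{mult}_{\mathcal F}(U,X)\approx \dfrac{\mathrm{mult}_{\mathcal H}(\alpha^{|U|},X)}{\binom{n}{|U|}}$. - **(F4)** For each such $U$ and $X$ and each $j\in[k]$: $\mathrm{mult}_{\mathcal F(j)}(U,X)\approx \dfrac{\mathrm{mult}_{\mathcal H(j)}(\alpha^{|U|},X)}{\binom{n}{|U|}}$. - **(C1)** For each $j\in[k]$: $c(\mathcal F(j))=c(\mathcal H(j))$ if and only if $\deg_{\mathcal H(j)}(\alpha)-\omega_\alpha(\mathcal H(j))\ge n-1$. -/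

import Mathlib

/-- `x ≈ y`: `⌊y⌋ ≤ x ≤ ⌈y⌉`. -/
def RoundsTo (x y : ℝ) : Prop :=
  (⌊y⌋ : ℝ) ≤ x ∧ x ≤ (⌈y⌉ : ℝ)

/-- A hypergraph with vertex set `V`. The members of `E` are the edges; `ends e` is the multiset
of vertices of the edge `e`. Distinct edges may have equal vertex multisets. -/
structure MultiHypergraph (V : Type*) (E : Type*) where
  ends : E → Multiset V

namespace MultiHypergraph

/-- The degree of `v`: the total number of occurrences of `v` among all edges. -/
def degree {V E : Type*} [DecidableEq V] [Fintype E] (G : MultiHypergraph V E) (v : V) : ℕ :=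
  ∑ e : E, (G.ends e).count v

/-- The number of edges whose multiset of vertices is `X`. -/
def mult {V E : Type*} [DecidableEq V] [Fintype E] (G : MultiHypergraph V E)
    (X : Multiset V) : ℕ :=
  (Finset.univ.filter fun e : E => G.ends e = X).card

/-- `G` is `v`-simple: no edge contains `v` more than once. -/
def IsSimpleAt {V E : Type*} [DecidableEq V] [Fintype E] (G : MultiHypergraph V E)
    (v : V) : Prop :=
  ∀ X : Multiset V, G.mult (Multiset.replicate 2 v + X) = 0

/-- The colour class `j`: the spanning sub-hypergraph formed by the edges of colour `j`. -/
def colorClass {V E C : Type*} (G : MultiHypergraph V E) (col : E → C) (j : C) :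
    MultiHypergraph V {e : E // col e = j} where
  ends e := G.ends e.1

/-- Two distinct vertices are adjacent when they lie in a common edge of `S`. -/
def shadow {V E : Type*} (G : MultiHypergraph V E) (S : Set E) : SimpleGraph V where
  Adj u v := u ≠ v ∧ ∃ e ∈ S, u ∈ G.ends e ∧ v ∈ G.ends e
  symm := ⟨fun _ _ h => ⟨h.1.symm, h.2.imp fun _ he => ⟨he.1, he.2.2, he.2.1⟩⟩⟩
  loopless := ⟨fun _ h => h.1 rfl⟩

/-- The number of components of `G`. -/
noncomputable def numComponents {V E : Type*} (G : MultiHypergraph V E) : ℕ :=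
  Nat.card (G.shadow Set.univ).ConnectedComponent

/-- A sub-hypergraph: a set of vertices and a set of edges lying inside it. -/
@[ext]
structure Sub {V E : Type*} (G : MultiHypergraph V E) where
  verts : Set V
  edges : Set E
  ends_mem : ∀ e ∈ edges, ∀ v ∈ G.ends e, v ∈ verts

namespace Sub

/-- At least one edge. -/
def IsNontrivial {V E : Type*} {G : MultiHypergraph V E} (W : G.Sub) : Prop :=
  W.edges.Nonempty

/-- There is a vertex, any two vertices are joined by a path of edges, and every edge has a vertex
(an edge with no vertices would be a piece of its own). -/
def IsConnected {V E : Type*} {G : MultiHypergraph V E} (W : G.Sub) : Prop :=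
  W.verts.Nonempty ∧
  (∀ u ∈ W.verts, ∀ v ∈ W.verts, (G.shadow W.edges).Reachable u v) ∧
  ∀ e ∈ W.edges, G.ends e ≠ 0

/-- `W` is the union of two nontrivial sub-hypergraphs that share the vertex `α`, no other
vertex, and no edge. -/
def IsCutVertex {V E : Type*} {G : MultiHypergraph V E} (W : G.Sub) (α : V) : Prop :=
  ∃ I J : G.Sub, I.IsNontrivial ∧ J.IsNontrivial ∧
    I.verts ∪ J.verts = W.verts ∧ I.edges ∪ J.edges = W.edges ∧
    I.verts ∩ J.verts = {α} ∧ I.edges ∩ J.edges = ∅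

/-- `W` is an `α`-wing of `G`. -/
structure IsWing {V E : Type*} {G : MultiHypergraph V E} (α : V) (W : G.Sub) : Prop where
  mem : α ∈ W.verts
  nontrivial : W.IsNontrivial
  connected : W.IsConnected
  not_cut : ¬ W.IsCutVertex α
  closed : ∀ e, e ∉ W.edges → ∀ v ∈ G.ends e, v ∈ W.verts → v = α

end Sub

/-- The number of `α`-wings of `G`. -/
noncomputable def numWings {V E : Type*} (G : MultiHypergraph V E) (α : V) : ℕ :=
  {W : G.Sub | W.IsWing α}.ncard

/-- The vertex set after `α` is replaced by `n` new vertices `α₁, …, αₙ` (the right summand). -/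
abbrev SplitVertex (V : Type*) (α : V) (n : ℕ) : Type _ :=
  {v : V // v ≠ α} ⊕ Fin n

/-- Identify all the new vertices with `α`. -/
def merge {V : Type*} (α : V) (n : ℕ) : SplitVertex V α n → V :=
  Sum.elim Subtype.val fun _ => α

/-- `F` is an `(α, n)`-detachment of `G`: each edge `e = {α^p} ∪ U` with `α ∉ U` becomes
`{α₁^{p₁}, …, αₙ^{pₙ}} ∪ U` with `p₁ + ⋯ + pₙ = p`. -/
def IsDetachment {V E : Type*} {α : V} {n : ℕ} (F : MultiHypergraph (SplitVertex V α n) E)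
    (G : MultiHypergraph V E) : Prop :=
  ∀ e : E, (F.ends e).map (merge α n) = G.ends e

/-- The multiset `U ∪ X` where `U` is a set of new vertices and `X` is a multiset of old ones. -/
def splitEdge {V : Type*} {α : V} {n : ℕ} (U : Finset (Fin n)) (X : Multiset {v : V // v ≠ α}) :
    Multiset (SplitVertex V α n) :=
  U.val.map Sum.inr + X.map Sum.inl

end MultiHypergraph

/-! The new vertices are split off one at a time. With `n + 1` of them still to be served, one
receives a set `I` of edges, at most one occurrence of `α` from each, so simplicity is automatic. If
`p e` occurrences of `α` remain in `e`, the fair share is the fractional point `p e / (n + 1)`, and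
`I` is an integral rounding of it that also rounds its sums over two laminar families of edge
classes, one governing degrees and wings, the other multiplicities. Such a rounding exists
(`exists_laminar_rounding`) because two laminar families behave like the two sides of a bipartite
graph: while some coordinate is fractional there is a direction preserving every integral sum, and
one moves along it until a further sum becomes integral. Rounded shares compose
(`RoundsTo.trans_div`), so evenness survives the induction in `exists_even_split`.

For connectivity, fix a colour. Its number of components is preserved exactly when the new vertices
are linked through wings (`IsDetachment.numComponents_eq_iff`, `IsDetachment.reachable_inr_iff`),
that is, when the bipartite graph of new vertices against wings, with one edge per occurrence of
`α`, is connected. A connected graph has at least one edge fewer than vertices, which gives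
necessity (`IsLinked.card_le`). For sufficiency, the wings met by `I` count as one wing once the new
vertex joins them. Single wings, and the union of the wings of weight at least two, are among the
rounded classes; hence the inequality passes to the remaining weights (`card_restWings_le`) and the
new vertex is attached to the later ones (`exists_hit_wing`). -/

/-! ### Laminar families and simultaneous rounding. -/

/-- Any two members of the family are nested or disjoint. -/
def IsLaminar {S : Type*} (𝒜 : Set (Finset S)) : Prop :=
  ∀ P ∈ 𝒜, ∀ Q ∈ 𝒜, P ⊆ Q ∨ Q ⊆ P ∨ Disjoint P Q

theorem IsLaminar.mono {S : Type*} {𝒜 ℬ : Set (Finset S)} (h : IsLaminar ℬ) (hs : 𝒜 ⊆ ℬ) :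
    IsLaminar 𝒜 := fun P hP Q hQ => h P (hs hP) Q (hs hQ)

/-- `m` sends each element to the least member of the family containing it, if there is one. -/
def IsLeastMember {S : Type*} (𝒜 : Set (Finset S)) (m : S → Option (Finset S)) : Prop :=
  (∀ s P, m s = some P → P ∈ 𝒜 ∧ s ∈ P) ∧ ∀ s, ∀ P ∈ 𝒜, s ∈ P → ∃ Q, m s = some Q ∧ Q ⊆ P

/-- The members containing a fixed element form a chain, so one of smallest cardinality lies in all
the others. -/
theorem IsLaminar.exists_isLeastMember {S : Type*} {𝒜 : Set (Finset S)} (h : IsLaminar 𝒜) :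
    ∃ m : S → Option (Finset S), IsLeastMember 𝒜 m := by
  have key : ∀ s, ∃ o : Option (Finset S), (∀ P, o = some P → P ∈ 𝒜 ∧ s ∈ P) ∧
      ∀ P ∈ 𝒜, s ∈ P → ∃ Q, o = some Q ∧ Q ⊆ P := by
    intro s
    by_cases hs : ∃ P, P ∈ 𝒜 ∧ s ∈ P
    · obtain ⟨Q, ⟨hQ, hsQ⟩, hmin⟩ :=
        WellFounded.has_min (measure (Finset.card (α := S))).wf {P | P ∈ 𝒜 ∧ s ∈ P} hs
      refine ⟨some Q, ?_, ?_⟩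
      · rintro P ⟨⟩
        exact ⟨hQ, hsQ⟩
      · intro P hP hsP
        refine ⟨Q, rfl, ?_⟩
        rcases h P hP Q hQ with h1 | h1 | h1
        · have h2 := hmin P ⟨hP, hsP⟩
          have h3 : Q.card ≤ P.card := not_lt.1 h2
          rw [Finset.eq_of_subset_of_card_le h1 h3]
        · exact h1
        · exact absurd hsQ (Finset.disjoint_left.1 h1 hsP)
    · refine ⟨none, by simp, ?_⟩
      intro P hP hsP
      exact absurd ⟨P, hP, hsP⟩ hs
  choose m hm1 hm2 using key
  exact ⟨m, hm1, hm2⟩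

/-- A member is the disjoint union of the fibres of `m` over its subsets, since the least member
around any of its elements lies inside it. -/
theorem IsLeastMember.sum_eq {S : Type*} [Fintype S] [DecidableEq S] {𝒜 : Set (Finset S)}
    {m : S → Option (Finset S)} (hm : IsLeastMember 𝒜 m) {P : Finset S} (hP : P ∈ 𝒜)
    (f : S → ℝ) :
    ∑ s ∈ P, f s = ∑ Q ∈ P.powerset, ∑ s with m s = some Q, f s := by
  classical
  -- The default `∅` is never used for `s ∈ P`: the member `P` guarantees that `m s` is not `none`.
  have h1 : ∀ s ∈ P, (m s).getD ∅ ∈ P.powerset := by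
    intro s hs
    obtain ⟨Q, hQ, hQP⟩ := hm.2 s P hP hs
    simpa [hQ] using hQP
  rw [← Finset.sum_fiberwise_of_maps_to h1]
  refine Finset.sum_congr rfl fun Q hQ => Finset.sum_congr ?_ fun _ _ => rfl
  ext s
  simp only [Finset.mem_filter, Finset.mem_univ, true_and]
  constructor
  · rintro ⟨hs, hsQ⟩
    obtain ⟨R, hR, -⟩ := hm.2 s P hP hs
    simp_all
  · intro hs
    exact ⟨Finset.mem_powerset.1 hQ (hm.1 s Q hs).2, by simp [hs]⟩

/-- Induction along inclusion: the fibre over `P` is `P` with the fibres over smaller sets removed,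
so its sum is a difference of integers. -/
theorem IsLeastMember.integral {S : Type*} [Fintype S] [DecidableEq S] {𝒜 : Set (Finset S)}
    {m : S → Option (Finset S)} (hm : IsLeastMember 𝒜 m) (x : S → ℝ)
    (hx : ∀ P ∈ 𝒜, ∑ s ∈ P, x s ∈ (Int.castAddHom ℝ).range)
    (P : Finset S) : ∑ s with m s = some P, x s ∈ (Int.castAddHom ℝ).range := by
  classical
  induction P using Finset.strongInduction with
  | H P ih =>
    by_cases hP : P ∈ 𝒜
    · have hz := hx P hP
      rw [hm.sum_eq hP, ← Finset.add_sum_erase _ _ (Finset.mem_powerset_self P)] at hz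
      refine (AddSubgroup.add_mem_cancel_right _ (sum_mem fun Q hQ => ih Q ?_)).1 hz
      rw [Finset.mem_erase, Finset.mem_powerset] at hQ
      exact hQ.2.ssubset_of_ne hQ.1
    · rw [Finset.filter_eq_empty_iff.2]
      · simp
      · intro s _ hs
        exact hP (hm.1 s P hs).1

/-- A homogeneous linear system with fewer equations than unknowns has a nonzero solution. -/
theorem exists_ne_zero_sum_fibres_eq_zero {F A B : Type*} [Fintype F] [DecidableEq A]
    [DecidableEq B] (p : F → A) (q : F → B) (P : Finset A) (Q : Finset B)
    (h : P.card + Q.card < Fintype.card F) :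
    ∃ z : F → ℝ, z ≠ 0 ∧ (∀ a ∈ P, ∑ f with p f = a, z f = 0) ∧
      ∀ b ∈ Q, ∑ f with q f = b, z f = 0 := by
  classical
  let L : (F → ℝ) →ₗ[ℝ] ((P ⊕ Q) → ℝ) := LinearMap.pi fun i =>
    Sum.elim (fun a : P => ∑ f with p f = a.1, LinearMap.proj f)
      (fun b : Q => ∑ f with q f = b.1, LinearMap.proj f) i
  have hL : LinearMap.ker L ≠ ⊥ := by
    apply LinearMap.ker_ne_bot_of_finrank_lt
    simpa using h
  obtain ⟨z, hz, hz0⟩ := (Submodule.ne_bot_iff _).1 hL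
  refine ⟨z, hz0, fun a ha => ?_, fun b hb => ?_⟩
  · simpa [L] using congrFun (LinearMap.mem_ker.1 hz) (Sum.inl ⟨a, ha⟩)
  · simpa [L] using congrFun (LinearMap.mem_ker.1 hz) (Sum.inr ⟨b, hb⟩)

theorem two_mul_card_image_erase_none_le {F A : Type*} [Fintype F] [DecidableEq A]
    (p : F → Option A) (hp : ∀ f a, p f = some a → ∃ f', f' ≠ f ∧ p f' = some a) :
    2 * ((Finset.univ.image p).erase none).card ≤ (Finset.univ.filter fun f => p f ≠ none).card := by
  classical
  have h1 : ∀ f ∈ Finset.univ.filter (fun f => p f ≠ none), p f ∈ (Finset.univ.image p).erase none := by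
    intro f hf
    simp only [Finset.mem_filter, Finset.mem_univ, true_and] at hf
    simp [hf]
  rw [Finset.card_eq_sum_card_fiberwise h1, mul_comm, ← smul_eq_mul]
  apply Finset.card_nsmul_le_sum
  intro a ha
  simp only [Finset.mem_erase, Finset.mem_image, Finset.mem_univ, true_and] at ha
  obtain ⟨ha, f, rfl⟩ := ha
  obtain ⟨b, hb⟩ := Option.ne_none_iff_exists'.1 ha
  obtain ⟨f', hne, hf'⟩ := hp f b hb
  refine Finset.one_lt_card.2 ⟨f, ?_, f', ?_, hne.symm⟩ <;> simp [hb, hf']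

theorem sum_fibre_eq_zero_of_mem_image {F A : Type*} [Fintype F] [DecidableEq A]
    (p : F → Option A) (z : F → ℝ)
    (h : ∀ a ∈ (Finset.univ.image p).erase none, ∑ f with p f = a, z f = 0) (a : A) :
    ∑ f with p f = some a, z f = 0 := by
  by_cases ha : some a ∈ (Finset.univ.image p).erase none
  · exact h _ ha
  · rw [Finset.filter_eq_empty_iff.2, Finset.sum_empty]
    intro f _ hf
    exact ha (Finset.mem_erase.2 ⟨by simp, Finset.mem_image.2 ⟨f, Finset.mem_univ f, hf⟩⟩)

/-- A nonzero weighting of the edges of a bipartite graph without pendant edges whose sum at every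
vertex vanishes. Edges are the elements of `F`, and `none` stands for a free end. -/
theorem exists_balanced_weighting {F A B : Type*} [Fintype F] [Nonempty F] [DecidableEq A]
    [DecidableEq B] (p : F → Option A) (q : F → Option B)
    (hp : ∀ f a, p f = some a → ∃ f', f' ≠ f ∧ p f' = some a)
    (hq : ∀ f b, q f = some b → ∃ f', f' ≠ f ∧ q f' = some b) :
    ∃ z : F → ℝ, z ≠ 0 ∧ (∀ a, ∑ f with p f = some a, z f = 0) ∧
      ∀ b, ∑ f with q f = some b, z f = 0 := by
  classical
  have hP := two_mul_card_image_erase_none_le p hp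
  have hQ := two_mul_card_image_erase_none_le q hq
  have hP' := Finset.card_filter_le (Finset.univ : Finset F) (fun f => p f ≠ none)
  have hQ' := Finset.card_filter_le (Finset.univ : Finset F) (fun f => q f ≠ none)
  rw [Finset.card_univ] at hP' hQ'
  -- The vertices on each side number at most half the edges with an end there. A free end makes one
  -- of these bounds strict against the number of edges, so there are fewer equations than unknowns.
  by_cases hnone : (∃ f, p f = none) ∨ ∃ f, q f = none
  · obtain ⟨z, hz, h1, h2⟩ := exists_ne_zero_sum_fibres_eq_zero p q
      ((Finset.univ.image p).erase none) ((Finset.univ.image q).erase none) (by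
        rcases hnone with ⟨f, hf⟩ | ⟨f, hf⟩
        · have : (Finset.univ.filter fun f => p f ≠ none).card < Fintype.card F :=
            Finset.card_lt_univ_of_notMem (x := f) (by simp [hf])
          omega
        · have : (Finset.univ.filter fun f => q f ≠ none).card < Fintype.card F :=
            Finset.card_lt_univ_of_notMem (x := f) (by simp [hf])
          omega)
    exact ⟨z, hz, sum_fibre_eq_zero_of_mem_image p z h1, sum_fibre_eq_zero_of_mem_image q z h2⟩
  -- Without free ends the equations of either side add up to the total sum of `z`, so the equation
  -- at `p f₀` follows from the others and can be dropped.
  · push Not at hnone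
    obtain ⟨f₀⟩ := ‹Nonempty F›
    have hf₀ : p f₀ ∈ (Finset.univ.image p).erase none := by simp [hnone.1 f₀]
    obtain ⟨z, hz, h1, h2⟩ := exists_ne_zero_sum_fibres_eq_zero p q
      (((Finset.univ.image p).erase none).erase (p f₀)) ((Finset.univ.image q).erase none) (by
        have := Finset.card_erase_lt_of_mem hf₀
        omega)
    refine ⟨z, hz, sum_fibre_eq_zero_of_mem_image p z fun a ha => ?_, sum_fibre_eq_zero_of_mem_image q z h2⟩
    by_cases hne : a = p f₀
    · have hsum : ∑ f, z f = 0 := by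
        rw [← Finset.sum_fiberwise_of_maps_to (t := (Finset.univ.image q).erase none) (g := q)
          (fun f _ => by simp [hnone.2 f])]
        exact Finset.sum_eq_zero h2
      rw [← Finset.sum_fiberwise_of_maps_to (t := (Finset.univ.image p).erase none) (g := p)
          (fun f _ => by simp [hnone.1 f]), ← Finset.add_sum_erase _ _ hf₀,
          Finset.sum_eq_zero h1, add_zero] at hsum
      rw [hne, hsum]
    · exact h1 a (Finset.mem_erase.2 ⟨hne, ha⟩)

/-- A direction in which a non-integral point can move without changing any integral coordinate or
any integral sum over a member of two laminar families. -/
theorem exists_direction {S : Type*} [Fintype S] [DecidableEq S] {𝒜 ℬ : Set (Finset S)}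
    (hA : IsLaminar 𝒜) (hB : IsLaminar ℬ) (x : S → ℝ)
    (hx : ∃ s, x s ∉ (Int.castAddHom ℝ).range) :
    ∃ z : S → ℝ, (∃ s, z s ≠ 0) ∧ (∀ s, x s ∈ (Int.castAddHom ℝ).range → z s = 0) ∧
      (∀ P ∈ 𝒜, ∑ s ∈ P, x s ∈ (Int.castAddHom ℝ).range → ∑ s ∈ P, z s = 0) ∧
      ∀ P ∈ ℬ, ∑ s ∈ P, x s ∈ (Int.castAddHom ℝ).range → ∑ s ∈ P, z s = 0 := by
  classical
  let F := {s // x s ∉ (Int.castAddHom ℝ).range}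
  have : Nonempty F := ⟨⟨hx.choose, hx.choose_spec⟩⟩
  -- The fractional elements become edges whose ends are the least integral-sum members around them.
  -- None is pendant: a single fractional element in a fibre with integral sum would itself be
  -- integral.
  have step {𝒜 : Set (Finset S)} (hA : IsLaminar 𝒜) : ∃ m,
      IsLeastMember {P | P ∈ 𝒜 ∧ ∑ s ∈ P, x s ∈ (Int.castAddHom ℝ).range} m ∧
        ∀ (f : F) a, m f.1 = some a → ∃ f' : F, f' ≠ f ∧ m f'.1 = some a := by
    obtain ⟨m, hm⟩ := IsLaminar.exists_isLeastMember
      (hA.mono (𝒜 := {P | P ∈ 𝒜 ∧ ∑ s ∈ P, x s ∈ (Int.castAddHom ℝ).range}) fun P hP => hP.1)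
    refine ⟨m, hm, fun f a hfa => ?_⟩
    by_contra! hcon
    have h1 := hm.integral x (fun P hP => hP.2) a
    rw [← Finset.add_sum_erase _ _ (a := f.1) (by simp [hfa])] at h1
    refine f.2 ((AddSubgroup.add_mem_cancel_right _ (sum_mem fun s hs => ?_)).1 h1)
    by_contra hs'
    simp only [Finset.mem_erase, Finset.mem_filter, Finset.mem_univ, true_and] at hs
    exact hcon ⟨s, hs'⟩ (fun h => hs.1 (congrArg Subtype.val h)) hs.2
  obtain ⟨m, hm, hm2⟩ := step hA
  obtain ⟨l, hl, hl2⟩ := step hB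
  obtain ⟨z, hz, h1, h2⟩ := exists_balanced_weighting (fun f : F => m f.1) (fun f : F => l f.1)
    hm2 hl2
  let y : S → ℝ := fun s => if h : x s ∉ (Int.castAddHom ℝ).range then z ⟨s, h⟩ else 0
  have hy (f : F) : y f.1 = z f := dif_pos f.2
  have hsum (m : S → Option (Finset S)) (a : Finset S) :
      ∑ s with m s = some a, y s = ∑ f : F with m f.1 = some a, z f := by
    have e1 : ∑ f : F with m f.1 = some a, z f = ∑ f : F, if m f.1 = some a then y f.1 else 0 := by
      rw [Finset.sum_filter]
      simp only [hy]
    rw [e1, Finset.sum_filter]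
    rw [← Finset.sum_subtype (Finset.univ.filter fun s => x s ∉ (Int.castAddHom ℝ).range)
      (by simp) (fun s => if m s = some a then y s else 0)]
    refine (Finset.sum_subset (Finset.subset_univ _) fun s _ hs => ?_).symm
    have : y s = 0 := dif_neg (by simpa using hs)
    simp [this]
  refine ⟨y, ?_, fun s hs => dif_neg (not_not.2 hs), fun P hP hPx => ?_, fun P hP hPx => ?_⟩
  · obtain ⟨f, hf⟩ := Function.ne_iff.1 hz
    exact ⟨f.1, by rw [hy]; exact hf⟩
  · rw [hm.sum_eq ⟨hP, hPx⟩]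
    exact Finset.sum_eq_zero fun Q _ => by rw [hsum, h1]
  · rw [hl.sum_eq ⟨hP, hPx⟩]
    exact Finset.sum_eq_zero fun Q _ => by rw [hsum, h2]

/-- Moving along a direction until a first sum becomes integral. -/
theorem exists_move_to_integral {S : Type*} (𝒞 : Finset (Finset S)) (x z : S → ℝ)
    (hz : ∃ P ∈ 𝒞, ∑ s ∈ P, z s ≠ 0) :
    ∃ t : ℝ, (∀ P ∈ 𝒞, (⌊∑ s ∈ P, x s⌋ : ℝ) ≤ ∑ s ∈ P, (x s + t * z s) ∧
        ∑ s ∈ P, (x s + t * z s) ≤ (⌈∑ s ∈ P, x s⌉ : ℝ)) ∧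
      ∃ P ∈ 𝒞, ∑ s ∈ P, z s ≠ 0 ∧ ∑ s ∈ P, (x s + t * z s) ∈ (Int.castAddHom ℝ).range := by
  classical
  -- For a sum that moves, `τ P` is the time at which it reaches its ceiling or floor, whichever
  -- lies ahead. Stopping at the least such time keeps every sum within its bounds.
  let τ : Finset S → ℝ := fun P => if 0 < ∑ s ∈ P, z s
    then (⌈∑ s ∈ P, x s⌉ - ∑ s ∈ P, x s) / ∑ s ∈ P, z s
    else (⌊∑ s ∈ P, x s⌋ - ∑ s ∈ P, x s) / ∑ s ∈ P, z s
  obtain ⟨P₀, hP₀, hmin⟩ := Finset.exists_min_image (𝒞.filter fun P => ∑ s ∈ P, z s ≠ 0) τ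
    (by obtain ⟨P, hP, h⟩ := hz; exact ⟨P, Finset.mem_filter.2 ⟨hP, h⟩⟩)
  rw [Finset.mem_filter] at hP₀
  have hτ (P : Finset S) : 0 ≤ τ P := by
    simp only [τ]
    split_ifs with h
    · exact div_nonneg (sub_nonneg.2 (Int.le_ceil _)) h.le
    · exact div_nonneg_of_nonpos (sub_nonpos.2 (Int.floor_le _)) (not_lt.1 h)
  refine ⟨τ P₀, fun P hP => ?_, P₀, hP₀.1, hP₀.2, ?_⟩
  · rw [Finset.sum_add_distrib, ← Finset.mul_sum]
    have hf := Int.floor_le (∑ s ∈ P, x s)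
    have hc := Int.le_ceil (∑ s ∈ P, x s)
    by_cases h0 : ∑ s ∈ P, z s = 0
    · rw [h0]
      constructor <;> linarith
    have hle := hmin P (Finset.mem_filter.2 ⟨hP, h0⟩)
    have h1 := hτ P₀
    generalize τ P₀ = t at *
    simp only [τ] at hle
    split_ifs at hle with h
    · rw [le_div_iff₀ h] at hle
      have := mul_nonneg h1 h.le
      constructor <;> linarith
    · have h' : ∑ s ∈ P, z s < 0 := lt_of_le_of_ne (not_lt.1 h) h0
      rw [le_div_iff_of_neg h'] at hle
      have := mul_nonpos_of_nonneg_of_nonpos h1 h'.le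
      constructor <;> linarith
  · rw [Finset.sum_add_distrib, ← Finset.mul_sum]
    simp only [τ]
    split_ifs with h
    · rw [div_mul_cancel₀ _ hP₀.2]
      exact ⟨⌈∑ s ∈ P₀, x s⌉, by simp⟩
    · rw [div_mul_cancel₀ _ hP₀.2]
      exact ⟨⌊∑ s ∈ P₀, x s⌋, by simp⟩

/-- A real point can be rounded to an integral one so that all its coordinates and all its sums over
the members of two laminar families are rounded. -/
theorem exists_laminar_rounding {S : Type*} [Fintype S] {𝒜 ℬ : Set (Finset S)}
    (hA : IsLaminar 𝒜) (hB : IsLaminar ℬ) (x : S → ℝ) :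
    ∃ g : S → ℤ, (∀ s, RoundsTo (g s) (x s)) ∧
      (∀ P ∈ 𝒜, RoundsTo (∑ s ∈ P, (g s : ℝ)) (∑ s ∈ P, x s)) ∧
      ∀ P ∈ ℬ, RoundsTo (∑ s ∈ P, (g s : ℝ)) (∑ s ∈ P, x s) := by
  classical
  -- Singletons are included so that coordinates are treated like all other sums.
  let 𝒞 : Finset (Finset S) := Finset.univ.filter fun P => P ∈ 𝒜 ∨ P ∈ ℬ ∨ ∃ s, P = {s}
  suffices h : ∃ g : S → ℤ, ∀ P ∈ 𝒞, RoundsTo (∑ s ∈ P, (g s : ℝ)) (∑ s ∈ P, x s) by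
    obtain ⟨g, hg⟩ := h
    refine ⟨g, fun s => ?_, fun P hP => hg P (by simp [𝒞, hP]), fun P hP => hg P (by simp [𝒞, hP])⟩
    simpa using hg {s} (by simp [𝒞])
  -- The induction is on the number of non-integral sums, which each move decreases.
  induction hN : (𝒞.filter fun P => ∑ s ∈ P, x s ∉ (Int.castAddHom ℝ).range).card
    using Nat.strong_induction_on generalizing x with
  | _ N ih =>
  subst hN
  by_cases hx : ∃ s, x s ∉ (Int.castAddHom ℝ).range
  · obtain ⟨z, ⟨s₀, hs₀⟩, hz0, hzA, hzB⟩ := exists_direction hA hB x hx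
    have hzC : ∀ P ∈ 𝒞, ∑ s ∈ P, x s ∈ (Int.castAddHom ℝ).range → ∑ s ∈ P, z s = 0 := by
      intro P hP hPx
      simp only [𝒞, Finset.mem_filter, Finset.mem_univ, true_and] at hP
      rcases hP with hP | hP | ⟨s, rfl⟩
      · exact hzA P hP hPx
      · exact hzB P hP hPx
      · rw [Finset.sum_singleton] at hPx ⊢
        exact hz0 s hPx
    obtain ⟨t, ht, P₀, hP₀, hP₀z, hP₀t⟩ := exists_move_to_integral 𝒞 x z
      ⟨{s₀}, by simp [𝒞], by simpa using hs₀⟩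
    obtain ⟨g, hg⟩ := ih _ (Finset.card_lt_card (Finset.ssubset_iff_of_subset (fun P hP => by
        simp only [Finset.mem_filter] at hP ⊢
        refine ⟨hP.1, fun hPx => hP.2 ?_⟩
        rwa [Finset.sum_add_distrib, ← Finset.mul_sum, hzC P hP.1 hPx, mul_zero, add_zero]) |>.2
          ⟨P₀, Finset.mem_filter.2 ⟨hP₀, fun h => hP₀z (hzC P₀ hP₀ h)⟩,
            fun h => absurd hP₀t (Finset.mem_filter.1 h).2⟩))
      (fun s => x s + t * z s) rfl
    refine ⟨g, fun P hP => ⟨?_, ?_⟩⟩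
    · exact le_trans (Int.cast_le.2 (Int.le_floor.2 (ht P hP).1)) (hg P hP).1
    · exact le_trans (hg P hP).2 (Int.cast_le.2 (Int.ceil_le.2 (ht P hP).2))
  · push Not at hx
    choose g hg using hx
    refine ⟨g, fun P _ => ?_⟩
    have : ∀ s, (g s : ℝ) = x s := hg
    simp only [this]
    exact ⟨Int.floor_le _, Int.le_ceil _⟩

/-- Reflection in an integer exchanges floor and ceiling; this handles what is left after a rounded
part is removed. -/
theorem RoundsTo.sub_left {a y : ℝ} (h : RoundsTo a y) (m : ℤ) : RoundsTo (m - a) (m - y) := by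
  constructor
  · have : ⌊(m : ℝ) - y⌋ = m - ⌈y⌉ := by
      rw [Int.floor_eq_iff]
      push_cast
      constructor <;> linarith [Int.le_ceil y, Int.ceil_lt_add_one y]
    rw [this]
    push_cast
    linarith [h.2]
  · have : ⌈(m : ℝ) - y⌉ = m - ⌊y⌋ := by
      rw [Int.ceil_eq_iff]
      push_cast
      constructor <;> linarith [Int.floor_le y, Int.lt_floor_add_one y]
    rw [this]
    push_cast
    linarith [h.1]

/-- The integer `⌊y / N⌋ * N` is at most `y`, hence at most `⌊y⌋`, hence at most `a`; the upper
bound is dual. This is what lets evenness compose along the induction. -/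
theorem RoundsTo.trans_div {a b y : ℝ} {N : ℕ} (hN : 0 < N) (ha : RoundsTo a y)
    (hb : RoundsTo b (a / N)) : RoundsTo b (y / N) := by
  have hN' : (0 : ℝ) < N := Nat.cast_pos.2 hN
  obtain ⟨ha1, ha2⟩ := ha
  obtain ⟨hb1, hb2⟩ := hb
  constructor
  · refine le_trans ?_ hb1
    rw [Int.cast_le, Int.le_floor, le_div_iff₀ hN']
    have h1 : ((⌊y / N⌋ * N : ℤ) : ℝ) ≤ y := by
      push_cast
      rw [← le_div_iff₀ hN']
      exact Int.floor_le _
    have h2 := Int.le_floor.2 h1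
    have h3 : ((⌊y / N⌋ * N : ℤ) : ℝ) ≤ (⌊y⌋ : ℝ) := Int.cast_le.2 h2
    push_cast at h3
    linarith
  · refine le_trans hb2 ?_
    rw [Int.cast_le, Int.ceil_le, div_le_iff₀ hN']
    have h1 : y ≤ ((⌈y / N⌉ * N : ℤ) : ℝ) := by
      push_cast
      rw [← div_le_iff₀ hN']
      exact Int.le_ceil _
    have h2 := Int.ceil_le.2 h1
    have h3 : (⌈y⌉ : ℝ) ≤ ((⌈y / N⌉ * N : ℤ) : ℝ) := Int.cast_le.2 h2
    push_cast at h3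
    linarith

/-! ### The even choice of edges for one new vertex. -/

namespace EdgeSplit

/-- Selects the edges of a given colour, or all edges. -/
def Sel {E C : Type*} (col : E → C) (c : Option C) (e : E) : Prop := ∀ j ∈ c, col e = j

theorem sel_nested {E C : Type*} {col : E → C} {c d : Option C} {e : E} (hc : Sel col c e) (hd : Sel col d e) :
    (∀ e', Sel col c e' → Sel col d e') ∨ ∀ e', Sel col d e' → Sel col c e' := by
  rcases c with _ | c
  · exact Or.inr (by simp [Sel])
  rcases d with _ | d
  · exact Or.inl (by simp [Sel])
  simp only [Sel, Option.mem_some_iff, forall_eq'] at *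
  subst hc
  subst hd
  exact Or.inl fun _ h => h

section
open Classical

variable {E C κ W : Type*} [Fintype E]

/-- The total weight of the edges of colour `j`. -/
noncomputable def colDeg (col : E → C) (p : E → ℕ) (j : C) : ℕ := ∑ e with col e = j, p e

/-- The labels of the edges of colour `j` of positive weight. -/
noncomputable def colWings (col : E → C) (p : E → ℕ) (w : E → W) (j : C) : Finset W :=
  (Finset.univ.filter fun e => col e = j ∧ 0 < p e).image w

/-- All elements of `Fin n` are linked through edges of colour `j` with equal labels. -/
def IsLinked {n : ℕ} (col : E → C) (w : E → W) (A : E → Finset (Fin n)) (j : C) : Prop :=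
  ∀ f : Fin n → Prop, (∀ e e', col e = j → col e' = j → w e = w e' →
    ∀ i ∈ A e, ∀ i' ∈ A e', (f i ↔ f i')) → ∀ i i', f i ↔ f i'

/-- The degree classes: all edges, the edges of one colour, the edges of one colour whose label has
total weight at least two, and the edges with one label. -/
def degreeFamily (col : E → C) (p : E → ℕ) (w : E → W) : Set (Finset E) :=
  {P | (∃ c, P = Finset.univ.filter (Sel col c)) ∨
    (∃ j, P = Finset.univ.filter fun e => col e = j ∧ 2 ≤ ∑ e' with w e' = w e, p e') ∨
    ∃ v, P = Finset.univ.filter fun e => w e = v}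

/-- The multiplicity classes. -/
def multFamily (col : E → C) (p : E → ℕ) (X : E → κ) : Set (Finset E) :=
  {P | ∃ u x c, P = Finset.univ.filter fun e => p e = u ∧ X e = x ∧ Sel col c e}

theorem isLaminar_of_mem {S : Type*} {𝒜 : Set (Finset S)}
    (h : ∀ P ∈ 𝒜, ∀ Q ∈ 𝒜, ∀ e ∈ P, e ∈ Q → P ⊆ Q ∨ Q ⊆ P) : IsLaminar 𝒜 := by
  intro P hP Q hQ
  by_cases hd : Disjoint P Q
  · exact Or.inr (Or.inr hd)
  · obtain ⟨e, he, he'⟩ := Finset.not_disjoint_iff.1 hd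
    rcases h P hP Q hQ e he he' with h | h
    · exact Or.inl h
    · exact Or.inr (Or.inl h)

/-- Labels determine colours, and having total weight at least two depends only on the label. So the
classes are nested: all edges, a colour, its heavy part, a label, where a label lies wholly inside
or outside the heavy part. -/
theorem isLaminar_degreeFamily (col : E → C) (p : E → ℕ) (w : E → W)
    (hw : ∀ e e', w e = w e' → col e = col e') : IsLaminar (degreeFamily col p w) := by
  apply isLaminar_of_mem
  rintro _ (⟨c, rfl⟩ | ⟨j, rfl⟩ | ⟨v, rfl⟩) _ (⟨c', rfl⟩ | ⟨j', rfl⟩ | ⟨v', rfl⟩) e he he' <;>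
    simp only [Finset.mem_filter, Finset.mem_univ, true_and, Finset.subset_iff] at he he' ⊢
  · exact sel_nested he he'
  · exact Or.inr fun a ha i hi => by rw [ha.1, ← he'.1, he i hi]
  · exact Or.inr fun a ha i hi => by rw [hw a e (ha.trans he'.symm), he i hi]
  · exact Or.inl fun a ha i hi => by rw [ha.1, ← he.1, he' i hi]
  · exact Or.inl fun a ha => ⟨by rw [ha.1, ← he.1, he'.1], ha.2⟩
  · refine Or.inr fun a ha => ?_
    subst ha
    rw [hw a e he'.symm, ← he']
    exact he
  · exact Or.inl fun a ha i hi => by rw [hw a e (ha.trans he.symm), he' i hi]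
  · refine Or.inl fun a ha => ?_
    subst ha
    rw [hw a e he.symm, ← he]
    exact he'
  · subst he
    subst he'
    exact Or.inl fun a ha => ha

theorem isLaminar_multFamily (col : E → C) (p : E → ℕ) (X : E → κ) :
    IsLaminar (multFamily col p X) := by
  apply isLaminar_of_mem
  rintro _ ⟨u, x, c, rfl⟩ _ ⟨u', x', c', rfl⟩ e he he'
  simp only [Finset.mem_filter, Finset.mem_univ, true_and, Finset.subset_iff] at he he' ⊢
  obtain ⟨rfl, rfl, he⟩ := he
  obtain ⟨rfl, rfl, he'⟩ := he'
  exact (sel_nested he he').imp (fun h a ha => ⟨ha.1, ha.2.1, h a ha.2.2⟩)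
    fun h a ha => ⟨ha.1, ha.2.1, h a ha.2.2⟩

/-- The edges that receive the new vertex, chosen so that all classes are split evenly. -/
theorem exists_even_choice (n : ℕ) (col : E → C) (p : E → ℕ) (X : E → κ) (w : E → W)
    (hw : ∀ e e', w e = w e' → col e = col e') (hp : ∀ e, p e ≤ n + 1) :
    ∃ I : Finset E, (∀ e ∈ I, 0 < p e) ∧ (∀ e, p e = n + 1 → e ∈ I) ∧
      (∀ P ∈ degreeFamily col p w,
        RoundsTo ((P ∩ I).card : ℝ) (((∑ e ∈ P, p e : ℕ) : ℝ) / (n + 1))) ∧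
      ∀ u x c, RoundsTo ((Finset.univ.filter fun e => p e = u ∧ X e = x ∧ Sel col c e ∧ e ∈ I).card : ℝ)
        (((Finset.univ.filter fun e => p e = u ∧ X e = x ∧ Sel col c e).card * u : ℝ) / (n + 1)) := by
  obtain ⟨g, hg, hgA, hgB⟩ := exists_laminar_rounding (isLaminar_degreeFamily col p w hw)
    (isLaminar_multFamily col p X) (fun e => (p e : ℝ) / (n + 1))
  have hn : (0 : ℝ) < n + 1 := by positivity
  -- The shares lie in `[0, 1]`, so the rounding is the indicator of a set of edges; shares equal to
  -- `0` or `1` are forced.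
  have hg01 : ∀ e, g e = 0 ∨ g e = 1 := by
    intro e
    have h0 : (0 : ℝ) ≤ (p e : ℝ) / (n + 1) := by positivity
    have h1 : (p e : ℝ) / (n + 1) ≤ 1 := by
      rw [div_le_one hn]
      exact_mod_cast hp e
    have h2 : 0 ≤ ⌊(p e : ℝ) / (n + 1)⌋ := Int.floor_nonneg.2 h0
    have h3 : ⌈(p e : ℝ) / (n + 1)⌉ ≤ 1 := Int.ceil_le.2 (by simpa using h1)
    have h4 : ⌊(p e : ℝ) / (n + 1)⌋ ≤ g e := by exact_mod_cast (hg e).1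
    have h5 : g e ≤ ⌈(p e : ℝ) / (n + 1)⌉ := by exact_mod_cast (hg e).2
    omega
  have hsum (P : Finset E) :
      ∑ e ∈ P, (g e : ℝ) = ((P ∩ Finset.univ.filter fun e => g e = 1).card : ℝ) := by
    rw [← Finset.filter_mem_eq_inter, Finset.card_filter, Nat.cast_sum]
    refine Finset.sum_congr rfl fun e _ => ?_
    rcases hg01 e with h | h <;> simp [h]
  refine ⟨Finset.univ.filter fun e => g e = 1, fun e he => ?_, fun e he => ?_, fun P hP => ?_,
    fun u x c => ?_⟩
  · by_contra h
    have h0 : p e = 0 := by omega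
    have h1 := (hg e).2
    simp only [Finset.mem_filter] at he
    rw [h0, he.2] at h1
    norm_num at h1
  · have h1 := (hg e).1
    rw [he] at h1
    have : ((n + 1 : ℕ) : ℝ) / (n + 1) = 1 := by
      push_cast
      exact div_self hn.ne'
    rw [this] at h1
    rcases hg01 e with h | h
    · rw [h] at h1
      norm_num at h1
    · simp [h]
  · have := hgA P hP
    rwa [hsum, ← Finset.sum_div, ← Nat.cast_sum] at this
  · have := hgB _ ⟨u, x, c, rfl⟩
    rw [hsum, ← Finset.sum_div] at this
    convert this using 2
    · congr 1
      ext e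
      simp [and_assoc]
    · rw [← nsmul_eq_mul, ← Finset.sum_const]
      refine Finset.sum_congr rfl fun e he => ?_
      simp only [Finset.mem_filter] at he
      rw [he.2.1]

end
end EdgeSplit

/-! ### Wings and weights after one vertex is split off. -/

namespace EdgeSplit

theorem mul_le_of_roundsTo {a b n : ℕ} (h : RoundsTo (a : ℝ) ((b : ℝ) / (n + 1))) :
    a * (n + 1) ≤ b + n := by
  have h1 : (a : ℝ) < (b : ℝ) / (n + 1) + 1 := h.2.trans_lt (Int.ceil_lt_add_one _)
  have hn : (0 : ℝ) < n + 1 := by positivity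
  rw [← sub_lt_iff_lt_add, lt_div_iff₀ hn] at h1
  have h2 : ((a * (n + 1) : ℕ) : ℝ) < ((b + n + 1 : ℕ) : ℝ) := by
    push_cast
    linarith
  have := Nat.cast_lt.1 h2
  omega

theorem one_le_of_roundsTo {a b n : ℕ} (h : RoundsTo (a : ℝ) ((b : ℝ) / (n + 1)))
    (hb : n + 1 ≤ b) : 1 ≤ a := by
  have hn : (0 : ℝ) < n + 1 := by positivity
  have h1 : (1 : ℤ) ≤ ⌊(b : ℝ) / (n + 1)⌋ := by
    rw [Int.le_floor, le_div_iff₀ hn]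
    push_cast
    rw [one_mul]
    exact_mod_cast hb
  have h2 : ((1 : ℤ) : ℝ) ≤ (a : ℝ) := le_trans (Int.cast_le.2 h1) h.1
  exact_mod_cast h2

/-- Here `D v` is the weight of the wing `v` and `s v` the part of it given to the new vertex. One
heavy wing already leaves a surplus of `n`, and without one every `s v` is at most one, so that the
sum of the `s v` is the number of wings hit. -/
theorem card_add_sum_le {ι : Type*} (S : Finset ι) (D s : ι → ℕ) (n : ℕ)
    (h1 : ∀ v ∈ S, 1 ≤ D v) (h2 : ∀ v ∈ S, s v ≤ D v) (h3 : ∀ v ∈ S, s v * (n + 1) ≤ D v + n)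
    (h : n + S.card ≤ ∑ v ∈ S, D v) :
    n + S.card + ∑ v ∈ S, s v ≤ ∑ v ∈ S, D v + (S.filter fun v => 0 < s v).card := by
  classical
  by_cases hbig : ∃ v ∈ S, n + 2 ≤ D v
  · obtain ⟨v, hv, hDv⟩ := hbig
    have key : s v + n ≤ D v := by
      have := h3 v hv
      by_contra! hcon
      have h5 : (D v + 1 - n) * (n + 1) ≤ D v + n :=
        le_trans (Nat.mul_le_mul_right _ (by omega)) this
      obtain ⟨r, hr⟩ := Nat.exists_eq_add_of_le hDv
      have h6 : D v + 1 - n = r + 3 := by omega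
      rw [h6, hr] at h5
      nlinarith
    rw [Finset.card_filter, Finset.card_eq_sum_ones, add_assoc, ← Finset.sum_add_distrib,
      ← Finset.sum_add_distrib, ← Finset.add_sum_erase _ _ hv, ← Finset.add_sum_erase _ _ hv]
    -- The other wings need no surplus: a wing that is hit is compensated by the indicator, a wing
    -- that is not has weight at least one.
    have : ∑ x ∈ S.erase v, (1 + s x) ≤ ∑ x ∈ S.erase v, (D x + if 0 < s x then 1 else 0) := by
      refine Finset.sum_le_sum fun x hx => ?_
      have := h1 x (Finset.mem_of_mem_erase hx)
      have := h2 x (Finset.mem_of_mem_erase hx)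
      split_ifs <;> omega
    have := h1 v hv
    have := h2 v hv
    split_ifs <;> omega
  · push Not at hbig
    have : ∑ v ∈ S, s v ≤ (S.filter fun v => 0 < s v).card := by
      rw [Finset.card_filter]
      refine Finset.sum_le_sum fun v hv => ?_
      have h5 := h3 v hv
      have h6 := hbig v hv
      have : s v ≤ 1 := by
        by_contra! hcon
        nlinarith [Nat.mul_le_mul_right (n + 1) hcon]
      split_ifs <;> omega
    omega

section
open Classical

variable {E C W : Type*}

/-- The weights left after the edges of `I` have received the new vertex. -/
noncomputable def restWeight (p : E → ℕ) (I : Finset E) (e : E) : ℕ := p e - if e ∈ I then 1 else 0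

/-- The labels after the edges of `I` have received the new vertex: in each colour the labels of
the edges of `I` are merged into one. -/
noncomputable def restLabel (col : E → C) (w : E → W) (I : Finset E) (e : E) : C ⊕ W :=
  if ∃ e' ∈ I, w e' = w e then Sum.inl (col e) else Sum.inr (w e)

theorem sum_restWeight (p : E → ℕ) (I : Finset E) (hI : ∀ e ∈ I, 0 < p e) (P : Finset E) :
    ∑ e ∈ P, restWeight p I e + (P ∩ I).card = ∑ e ∈ P, p e := by
  rw [← Finset.filter_mem_eq_inter, Finset.card_filter, ← Finset.sum_add_distrib]
  refine Finset.sum_congr rfl fun e _ => ?_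
  unfold restWeight
  split_ifs with h
  · have := hI e h
    omega
  · omega

/-- Keeps the hypothesis on labels valid for the induction. -/
theorem restLabel_color {col : E → C} {w : E → W} (hw : ∀ e e', w e = w e' → col e = col e')
    {I : Finset E} (e e' : E) (h : restLabel col w I e = restLabel col w I e') :
    col e = col e' := by
  unfold restLabel at h
  split_ifs at h with h1 h2
  · exact Sum.inl_injective h
  · exact hw e e' (Sum.inr_injective h)

variable [Fintype E]

theorem sum_color_eq_sum_wings (col : E → C) (p : E → ℕ) (w : E → W)
    (hw : ∀ e e', w e = w e' → col e = col e') (f : E → ℕ) (hf : ∀ e, 0 < f e → 0 < p e) (j : C) :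
    ∑ e with col e = j, f e = ∑ v ∈ colWings col p w j, ∑ e with w e = v, f e := by
  have h1 : ∑ e with col e = j, f e = ∑ e with col e = j ∧ 0 < p e, f e := by
    symm
    apply Finset.sum_subset
    · exact Finset.monotone_filter_right _ fun e _ h => h.1
    · intro e he he'
      simp only [Finset.mem_filter, Finset.mem_univ, true_and] at he he'
      by_contra h
      exact he' ⟨he, hf e (Nat.pos_of_ne_zero h)⟩
  rw [h1, ← Finset.sum_fiberwise_of_maps_to (t := colWings col p w j) (g := w)
    (fun e he => Finset.mem_image_of_mem w he)]
  refine Finset.sum_congr rfl fun v hv => ?_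
  apply Finset.sum_subset
  · intro e he
    simp only [Finset.mem_filter, Finset.mem_univ, true_and] at he ⊢
    exact he.2
  · intro e he he'
    obtain ⟨e₀, he₀, rfl⟩ := Finset.mem_image.1 hv
    simp only [Finset.mem_filter, Finset.mem_univ, true_and] at he he' he₀
    by_contra h
    exact he' ⟨⟨(hw e e₀ he).trans he₀.1, hf e (Nat.pos_of_ne_zero h)⟩, he⟩

theorem mem_colWings {col : E → C} {p : E → ℕ} {w : E → W} {j : C} {v : W} :
    v ∈ colWings col p w j ↔ ∃ e, col e = j ∧ 0 < p e ∧ w e = v := by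
  simp [colWings, and_assoc]

theorem one_le_wing_sum {col : E → C} {p : E → ℕ} {w : E → W} {j : C} {v : W}
    (hv : v ∈ colWings col p w j) : 1 ≤ ∑ e with w e = v, p e := by
  obtain ⟨e, he, rfl⟩ := Finset.mem_image.1 hv
  simp only [Finset.mem_filter, Finset.mem_univ, true_and] at he
  exact le_trans he.2 (Finset.single_le_sum (f := p) (fun _ _ => Nat.zero_le _) (by simp))

/-- The inequality is inherited: the weight drops by the number of incidences given away, while all
wings that were hit become at most one, and `card_add_sum_le` compares the two losses. -/
theorem card_restWings_le {n : ℕ} {col : E → C} {p : E → ℕ} {w : E → W}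
    (hw : ∀ e e', w e = w e' → col e = col e') {I : Finset E} (hI : ∀ e ∈ I, 0 < p e)
    (hround : ∀ v, RoundsTo (((Finset.univ.filter fun e => w e = v) ∩ I).card : ℝ)
      (((∑ e with w e = v, p e : ℕ) : ℝ) / (n + 1))) {j : C}
    (h : n + (colWings col p w j).card ≤ colDeg col p j) :
    n + (colWings col (restWeight p I) (restLabel col w I) j).card ≤
      colDeg col (restWeight p I) j + 1 := by
  set D : W → ℕ := fun v => ∑ e with w e = v, p e with hD
  set s : W → ℕ := fun v => ((Finset.univ.filter fun e => w e = v) ∩ I).card with hs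
  have hd : colDeg col p j = ∑ v ∈ colWings col p w j, D v :=
    sum_color_eq_sum_wings col p w hw p (fun _ h => h) j
  have hsI : ((Finset.univ.filter fun e => col e = j) ∩ I).card = ∑ v ∈ colWings col p w j, s v := by
    have := sum_color_eq_sum_wings col p w hw (fun e => if e ∈ I then 1 else 0)
      (fun e he => hI e (by by_contra h; simp [h] at he)) j
    simp only [hs, ← Finset.filter_mem_eq_inter, Finset.card_filter]
    exact this
  have hrest := sum_restWeight p I hI (Finset.univ.filter fun e => col e = j)
  have hmain := card_add_sum_le (colWings col p w j) D s n (fun v hv => one_le_wing_sum hv)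
    (fun v _ => by
      have := sum_restWeight p I hI (Finset.univ.filter fun e => w e = v)
      simp only [hD, hs]
      omega) (fun v _ => mul_le_of_roundsTo (hround v)) (hd ▸ h)
  have hcard : (colWings col (restWeight p I) (restLabel col w I) j).card ≤
      1 + ((colWings col p w j).filter fun v => ¬ 0 < s v).card := by
    -- The single label `Sum.inl j` stands for all hit wings; a wing that was not hit keeps its
    -- label.
    refine le_trans (Finset.card_le_card (t := Finset.disjSum {j}
      ((colWings col p w j).filter fun v => ¬ 0 < s v)) ?_) ?_
    · intro v hv
      obtain ⟨e, hej, hep, rfl⟩ := mem_colWings.1 hv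
      unfold restLabel
      split_ifs with hhit
      · rw [hej]
        exact Finset.inl_mem_disjSum.2 (Finset.mem_singleton_self j)
      · refine Finset.inr_mem_disjSum.2 (Finset.mem_filter.2 ⟨?_, ?_⟩)
        · exact mem_colWings.2 ⟨e, hej, lt_of_lt_of_le hep (Nat.sub_le _ _), rfl⟩
        · rw [not_lt, Nat.le_zero, Finset.card_eq_zero, Finset.eq_empty_iff_forall_notMem]
          intro e' he'
          rw [Finset.mem_inter, Finset.mem_filter] at he'
          exact hhit ⟨e', he'.2, he'.1.2⟩
    · rw [Finset.card_disjSum, Finset.card_singleton]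
  have hsplit := Finset.card_filter_add_card_filter_not (s := colWings col p w j) (fun v => 0 < s v)
  have hd' : colDeg col (restWeight p I) j + ∑ v ∈ colWings col p w j, s v =
      ∑ v ∈ colWings col p w j, D v := by
    rw [← hsI, ← hd]
    exact hrest
  omega

/-- Provides a wing that joins the new vertex to one of the later vertices. As `n ≥ 1`, some wing
has weight at least two, so the light wings number fewer than all wings and the heavy ones carry
weight at least `n + 1`. The heavy class is rounded, hence hit. -/
theorem exists_hit_wing {n : ℕ} (hn : 1 ≤ n) {col : E → C} {p : E → ℕ} {w : E → W}
    (hw : ∀ e e', w e = w e' → col e = col e') {I : Finset E} (hI : ∀ e ∈ I, 0 < p e)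
    (hround : ∀ P ∈ degreeFamily col p w,
        RoundsTo ((P ∩ I).card : ℝ) (((∑ e ∈ P, p e : ℕ) : ℝ) / (n + 1))) {j : C}
    (h : n + (colWings col p w j).card ≤ colDeg col p j) :
    ∃ e ∈ I, col e = j ∧ ∃ e', w e' = w e ∧ 0 < restWeight p I e' := by
  set big : Finset E :=
    Finset.univ.filter fun e => col e = j ∧ 2 ≤ ∑ e' with w e' = w e, p e' with hbig
  have hsum : n + 1 ≤ ∑ e ∈ big, p e := by
    have hb := sum_color_eq_sum_wings col p w hw
      (fun e => if 2 ≤ ∑ e' with w e' = w e, p e' then p e else 0)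
      (fun e he => by by_contra h0; simp only [not_lt, Nat.le_zero] at h0; simp [h0] at he) j
    rw [← Finset.sum_filter, Finset.filter_filter] at hb
    rw [hbig, hb]
    rw [colDeg, sum_color_eq_sum_wings col p w hw p (fun _ h => h) j] at h
    let D : W → ℕ := fun v => ∑ e with w e = v, p e
    have hD : n + (colWings col p w j).card ≤ ∑ v ∈ colWings col p w j, D v := h
    have hv : ∀ v ∈ colWings col p w j,
        ∑ e with w e = v, (if 2 ≤ ∑ e' with w e' = w e, p e' then p e else 0) =
          if 2 ≤ D v then D v else 0 := by
      intro v _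
      split_ifs with hDv
      · refine Finset.sum_congr rfl fun e he => ?_
        rw [(Finset.mem_filter.1 he).2]
        exact if_pos hDv
      · refine Finset.sum_eq_zero fun e he => ?_
        rw [(Finset.mem_filter.1 he).2]
        exact if_neg hDv
    rw [Finset.sum_congr rfl hv]
    have h1 : ∀ v ∈ colWings col p w j, D v ≤ 1 + if 2 ≤ D v then D v else 0 := by
      intro v _
      split_ifs <;> omega
    have hex : ∃ v ∈ colWings col p w j, 2 ≤ D v := by
      by_contra! hcon
      have : ∑ v ∈ colWings col p w j, D v ≤ ∑ v ∈ colWings col p w j, 1 :=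
        Finset.sum_le_sum fun v hv => Nat.le_of_lt_succ (hcon v hv)
      rw [← Finset.card_eq_sum_ones] at this
      omega
    obtain ⟨v, hv, hv2⟩ := hex
    have h2 : ∑ v ∈ colWings col p w j, D v <
        ∑ v ∈ colWings col p w j, (1 + if 2 ≤ D v then D v else 0) :=
      Finset.sum_lt_sum h1 ⟨v, hv, by rw [if_pos hv2]; omega⟩
    rw [Finset.sum_add_distrib, ← Finset.card_eq_sum_ones] at h2
    omega
  have hone := one_le_of_roundsTo (hround big (Or.inr (Or.inl ⟨j, rfl⟩))) hsum
  obtain ⟨e, he⟩ := Finset.card_pos.1 hone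
  rw [Finset.mem_inter, hbig, Finset.mem_filter] at he
  refine ⟨e, he.2, he.1.2.1, ?_⟩
  -- If the wing were used up, its weight `D ≥ 2` would satisfy `D * (n + 1) ≤ D + n`, which is
  -- impossible for `n ≥ 1`.
  by_contra! hcon
  have h1 := sum_restWeight p I hI (Finset.univ.filter fun e' => w e' = w e)
  rw [Finset.sum_eq_zero (fun e' he' => Nat.le_zero.1 (hcon e' (Finset.mem_filter.1 he').2)),
    zero_add] at h1
  have h2 := mul_le_of_roundsTo (hround _ (Or.inr (Or.inr ⟨w e, rfl⟩)))
  have h3 := he.1.2.2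
  rw [h1] at h2
  nlinarith

end
end EdgeSplit

/-! ### Adjoining the last vertex to a split of the remaining weights. -/

namespace EdgeSplit
section
open Classical

variable {E C κ W : Type*}

/-- Adjoin the last index to the sets of the edges of `I`. -/
noncomputable def extendSplit {n : ℕ} (A : E → Finset (Fin n)) (I : Finset E) (e : E) :
    Finset (Fin (n + 1)) :=
  if e ∈ I then insert (Fin.last n) ((A e).map Fin.castSuccEmb) else (A e).map Fin.castSuccEmb

theorem castSucc_mem_extendSplit {n : ℕ} {A : E → Finset (Fin n)} {I : Finset E} {e : E}
    {i : Fin n} : i.castSucc ∈ extendSplit A I e ↔ i ∈ A e := by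
  unfold extendSplit
  split_ifs <;> simp [Fin.castSucc_ne_last]

theorem last_mem_extendSplit {n : ℕ} {A : E → Finset (Fin n)} {I : Finset E} {e : E} :
    Fin.last n ∈ extendSplit A I e ↔ e ∈ I := by
  unfold extendSplit
  split_ifs with h <;> simp [Fin.castSucc_ne_last, h]

theorem last_notMem_map {n : ℕ} (s : Finset (Fin n)) : Fin.last n ∉ s.map Fin.castSuccEmb := by
  simp [Fin.castSucc_ne_last]

theorem card_extendSplit {n : ℕ} (A : E → Finset (Fin n)) (I : Finset E) (e : E) :
    (extendSplit A I e).card = (A e).card + if e ∈ I then 1 else 0 := by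
  unfold extendSplit
  split_ifs
  · rw [Finset.card_insert_of_notMem (last_notMem_map _), Finset.card_map]
  · rw [Finset.card_map, add_zero]

theorem exists_eq_map_castSucc {n : ℕ} (U : Finset (Fin (n + 1))) :
    ∃ U' : Finset (Fin n), U = U'.map Fin.castSuccEmb ∨
      U = insert (Fin.last n) (U'.map Fin.castSuccEmb) := by
  refine ⟨Finset.univ.filter fun i => i.castSucc ∈ U, ?_⟩
  by_cases h : Fin.last n ∈ U
  · right
    ext i
    refine Fin.lastCases ?_ (fun i => ?_) i
    · simp [h]
    · simp [Fin.castSucc_ne_last]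
  · left
    ext i
    refine Fin.lastCases ?_ (fun i => ?_) i
    · simp [h, Fin.castSucc_ne_last]
    · simp

theorem extendSplit_eq_map {n : ℕ} {A : E → Finset (Fin n)} {I : Finset E} {e : E}
    {U : Finset (Fin n)} : extendSplit A I e = U.map Fin.castSuccEmb ↔ e ∉ I ∧ A e = U := by
  constructor
  · intro h
    refine ⟨fun he => last_notMem_map U (h ▸ last_mem_extendSplit.2 he), ?_⟩
    ext i
    rw [← castSucc_mem_extendSplit (I := I), h]
    simp
  · rintro ⟨he, rfl⟩
    simp [extendSplit, he]

theorem extendSplit_eq_insert {n : ℕ} {A : E → Finset (Fin n)} {I : Finset E} {e : E}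
    {U : Finset (Fin n)} :
    extendSplit A I e = insert (Fin.last n) (U.map Fin.castSuccEmb) ↔ e ∈ I ∧ A e = U := by
  constructor
  · intro h
    refine ⟨last_mem_extendSplit.1 (h ▸ Finset.mem_insert_self _ _), ?_⟩
    ext i
    rw [← castSucc_mem_extendSplit (I := I), h]
    simp [Fin.castSucc_ne_last]
  · rintro ⟨he, rfl⟩
    simp [extendSplit, he]

/-- Labels that were merged belong to hit wings, which are linked through the last vertex, so old
links survive. The edge from `hhit` ties the last vertex to the others; for `n = 0` there are no
others. -/
theorem isLinked_extendSplit {n : ℕ} {col : E → C} {w : E → W} {A : E → Finset (Fin n)}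
    {I : Finset E} {j : C} (hw : ∀ e e', w e = w e' → col e = col e')
    (h : IsLinked col (restLabel col w I) A j)
    (hhit : 1 ≤ n → ∃ e ∈ I, col e = j ∧ ∃ e', w e' = w e ∧ (A e').Nonempty) :
    IsLinked col w (extendSplit A I) j := by
  intro f hf
  have hold : ∀ i i' : Fin n, f i.castSucc ↔ f i'.castSucc := by
    apply h (fun i => f i.castSucc)
    intro e e' he he' hl i hi i' hi'
    have hi := castSucc_mem_extendSplit (I := I).2 hi
    have hi' := castSucc_mem_extendSplit (I := I).2 hi'
    unfold restLabel at hl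
    split_ifs at hl with h1 h2 h2
    · obtain ⟨a, ha, hae⟩ := h1
      obtain ⟨b, hb, hbe⟩ := h2
      -- From `i` to the last vertex inside the wing of `a`, then on to `i'` inside the wing of `b`.
      exact (hf e a he ((hw a e hae).trans he) hae.symm _ hi _ (last_mem_extendSplit.2 ha)).trans
        (hf b e' ((hw b e' hbe).trans he') he' hbe _ (last_mem_extendSplit.2 hb) _ hi')
    · exact hf e e' he he' (Sum.inr_injective hl) _ hi _ hi'
  have hlast : ∀ i : Fin n, f (Fin.last n) ↔ f i.castSucc := by
    intro i
    obtain ⟨e, heI, hej, e', hee', i', hi'⟩ := hhit (by have := i.2; omega)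
    exact (hf e e' hej ((hw e' e hee').trans hej) hee'.symm _ (last_mem_extendSplit.2 heI) _
      (castSucc_mem_extendSplit.2 hi')).trans (hold i' i)
  intro i i'
  refine Fin.lastCases ?_ (fun i => ?_) i <;> refine Fin.lastCases ?_ (fun i' => ?_) i'
  · exact Iff.rfl
  · exact hlast i'
  · exact (hlast i).symm
  · exact hold i i'

theorem roundsTo_degree_last {n : ℕ} {p : E → ℕ} {I P : Finset E} {A : E → Finset (Fin n)}
    (h : RoundsTo ((P ∩ I).card : ℝ) (((∑ e ∈ P, p e : ℕ) : ℝ) / (n + 1))) :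
    RoundsTo (((P.filter fun e => Fin.last n ∈ extendSplit A I e).card : ℕ) : ℝ)
      (((∑ e ∈ P, p e : ℕ) : ℝ) / ((n + 1 : ℕ) : ℝ)) := by
  simp only [last_mem_extendSplit, Finset.filter_mem_eq_inter]
  push_cast at h ⊢
  exact h

/-- With total `d`, the rest is a rounding of `d - d / (n + 1) = d * n / (n + 1)`, and an equal
share of it among `n` vertices is again `d / (n + 1)`. -/
theorem roundsTo_degree_castSucc {n : ℕ} {p : E → ℕ} {I P : Finset E} {A : E → Finset (Fin n)}
    (hI : ∀ e ∈ I, 0 < p e)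
    (h : RoundsTo ((P ∩ I).card : ℝ) (((∑ e ∈ P, p e : ℕ) : ℝ) / (n + 1))) (i : Fin n)
    (h' : RoundsTo (((P.filter fun e => i ∈ A e).card : ℕ) : ℝ)
      (((∑ e ∈ P, restWeight p I e : ℕ) : ℝ) / (n : ℝ))) :
    RoundsTo (((P.filter fun e => i.castSucc ∈ extendSplit A I e).card : ℕ) : ℝ)
      (((∑ e ∈ P, p e : ℕ) : ℝ) / ((n + 1 : ℕ) : ℝ)) := by
  have hn : 0 < n := i.pos
  have hn' : (0 : ℝ) < n := Nat.cast_pos.2 hn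
  simp only [castSucc_mem_extendSplit]
  have hs : ((∑ e ∈ P, restWeight p I e : ℕ) : ℝ) =
      ((∑ e ∈ P, p e : ℕ) : ℝ) - ((P ∩ I).card : ℝ) := by
    rw [← sum_restWeight p I hI P, Nat.cast_add, add_sub_cancel_right]
  have h1 := h.sub_left ((∑ e ∈ P, p e : ℕ) : ℤ)
  rw [Int.cast_natCast, ← hs] at h1
  have h2 := h1.trans_div hn h'
  convert h2 using 1
  push_cast
  field_simp
  ring

variable [Fintype E]

/-- With `u = U.card`, the shares `(u + 1) / (n + 1)` and `1 / C(n, u)` multiply to `1 / C(n + 1, u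
+ 1)`. -/
theorem roundsTo_mult_insert {n : ℕ} {p : E → ℕ} {I : Finset E} {q : E → Prop}
    {A : E → Finset (Fin n)} (hI : ∀ e ∈ I, 0 < p e) (U : Finset (Fin n))
    (h : RoundsTo ((Finset.univ.filter fun e => p e = U.card + 1 ∧ q e ∧ e ∈ I).card : ℝ)
      (((Finset.univ.filter fun e => p e = U.card + 1 ∧ q e).card * (U.card + 1 : ℕ) : ℝ) /
        (n + 1)))
    (h' : RoundsTo ((Finset.univ.filter fun e => A e = U ∧ q e ∧ e ∈ I).card : ℝ)
      (((Finset.univ.filter fun e => restWeight p I e = U.card ∧ q e ∧ e ∈ I).card : ℝ) /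
        (n.choose U.card : ℕ))) :
    RoundsTo ((Finset.univ.filter fun e =>
        extendSplit A I e = insert (Fin.last n) (U.map Fin.castSuccEmb) ∧ q e).card : ℝ)
      (((Finset.univ.filter fun e => p e = U.card + 1 ∧ q e).card : ℝ) /
        ((n + 1).choose (U.card + 1) : ℕ)) := by
  have e1 : (Finset.univ.filter fun e =>
      extendSplit A I e = insert (Fin.last n) (U.map Fin.castSuccEmb) ∧ q e) =
      Finset.univ.filter fun e => A e = U ∧ q e ∧ e ∈ I := by
    ext e
    simp only [extendSplit_eq_insert, Finset.mem_filter]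
    tauto
  have e2 : (Finset.univ.filter fun e => restWeight p I e = U.card ∧ q e ∧ e ∈ I) =
      Finset.univ.filter fun e => p e = U.card + 1 ∧ q e ∧ e ∈ I := by
    ext e
    simp only [Finset.mem_filter, Finset.mem_univ, true_and]
    refine and_congr_left fun he => ?_
    have := hI e he.2
    rw [restWeight, if_pos he.2]
    omega
  rw [e1]
  rw [e2] at h'
  have hU : U.card ≤ n := by simpa using Finset.card_le_univ U
  have hpos : 0 < n.choose U.card := Nat.choose_pos hU
  have h2 := h.trans_div hpos h'
  convert h2 using 1
  have hch := Nat.add_one_mul_choose_eq n U.card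
  have hch' : ((n : ℝ) + 1) * (n.choose U.card : ℕ) =
      ((n + 1).choose (U.card + 1) : ℕ) * ((U.card : ℝ) + 1) := by exact_mod_cast hch
  have hpos' : ((n.choose U.card : ℕ) : ℝ) ≠ 0 := by exact_mod_cast hpos.ne'
  have hpos2 : (((n + 1).choose (U.card + 1) : ℕ) : ℝ) ≠ 0 := by
    exact_mod_cast (Nat.choose_pos (by omega)).ne'
  have hn : ((n : ℝ) + 1) ≠ 0 := by positivity
  rw [div_div, hch']
  push_cast
  field_simp

/-- The edges outside `I` make up the share `1 - u / (n + 1)`, where `u = U.card`; divided by `C(n,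
u)` this is `1 / C(n + 1, u)`. -/
theorem roundsTo_mult_map {n : ℕ} {p : E → ℕ} {I : Finset E} {q : E → Prop}
    {A : E → Finset (Fin n)} (U : Finset (Fin n))
    (h : RoundsTo ((Finset.univ.filter fun e => p e = U.card ∧ q e ∧ e ∈ I).card : ℝ)
      (((Finset.univ.filter fun e => p e = U.card ∧ q e).card * (U.card : ℕ) : ℝ) /
        (n + 1)))
    (h' : RoundsTo ((Finset.univ.filter fun e => A e = U ∧ q e ∧ e ∉ I).card : ℝ)
      (((Finset.univ.filter fun e => restWeight p I e = U.card ∧ q e ∧ e ∉ I).card : ℝ) /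
        (n.choose U.card : ℕ))) :
    RoundsTo ((Finset.univ.filter fun e =>
        extendSplit A I e = U.map Fin.castSuccEmb ∧ q e).card : ℝ)
      (((Finset.univ.filter fun e => p e = U.card ∧ q e).card : ℝ) /
        ((n + 1).choose U.card : ℕ)) := by
  have e1 : (Finset.univ.filter fun e => extendSplit A I e = U.map Fin.castSuccEmb ∧ q e) =
      Finset.univ.filter fun e => A e = U ∧ q e ∧ e ∉ I := by
    ext e
    simp only [extendSplit_eq_map, Finset.mem_filter]
    tauto
  have e2 : (Finset.univ.filter fun e => restWeight p I e = U.card ∧ q e ∧ e ∉ I) =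
      Finset.univ.filter fun e => p e = U.card ∧ q e ∧ e ∉ I := by
    ext e
    simp only [Finset.mem_filter, Finset.mem_univ, true_and]
    refine and_congr_left fun he => ?_
    rw [restWeight, if_neg he.2, Nat.sub_zero]
  rw [e1]
  rw [e2] at h'
  have e3 : ((Finset.univ.filter fun e => p e = U.card ∧ q e ∧ e ∉ I).card : ℝ) =
      ((Finset.univ.filter fun e => p e = U.card ∧ q e).card : ℝ) -
        (Finset.univ.filter fun e => p e = U.card ∧ q e ∧ e ∈ I).card := by
    have := Finset.card_filter_add_card_filter_not
      (s := Finset.univ.filter fun e => p e = U.card ∧ q e) (fun e => e ∈ I)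
    simp only [Finset.filter_filter, and_assoc] at this
    rw [← this]
    push_cast
    ring
  have h1 := h.sub_left ((Finset.univ.filter fun e => p e = U.card ∧ q e).card : ℤ)
  rw [Int.cast_natCast, ← e3] at h1
  have hU : U.card ≤ n := by simpa using Finset.card_le_univ U
  have hpos : 0 < n.choose U.card := Nat.choose_pos hU
  have h2 := h1.trans_div hpos h'
  convert h2 using 1
  have hch := Nat.choose_mul_succ_eq n U.card
  have hch' : ((n.choose U.card : ℕ) : ℝ) * (n + 1) =
      ((n + 1).choose U.card : ℕ) * ((n : ℝ) + 1 - U.card) := by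
    have : ((n + 1 - U.card : ℕ) : ℝ) = (n : ℝ) + 1 - U.card := by
      rw [Nat.cast_sub (by omega)]
      push_cast
      ring
    rw [← this]
    exact_mod_cast hch
  have hpos' : ((n.choose U.card : ℕ) : ℝ) ≠ 0 := by exact_mod_cast hpos.ne'
  have hpos2 : (((n + 1).choose U.card : ℕ) : ℝ) ≠ 0 := by
    exact_mod_cast (Nat.choose_pos (by omega)).ne'
  have hn : ((n : ℝ) + 1) ≠ 0 := by positivity
  rw [eq_div_iff hpos', div_mul_eq_mul_div, div_eq_iff hpos2]
  have : ∀ m : ℝ, m - m * U.card / (n + 1) = m * (n + 1 - U.card) / (n + 1) := by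
    intro m
    field_simp
  rw [this, div_mul_eq_mul_div, eq_div_iff hn]
  linear_combination (((Finset.univ.filter fun e => p e = U.card ∧ q e).card : ℕ) : ℝ) * hch'

end

theorem card_filter_cast_congr {E : Type*} [Fintype E] {a b : E → Prop}
    {_ : DecidablePred a} {_ : DecidablePred b} (h : ∀ e, a e ↔ b e) :
    ((Finset.univ.filter a).card : ℝ) = (Finset.univ.filter b).card := by
  congr 2
  ext e
  simp [h]

theorem _root_.RoundsTo.congr {a a' y y' : ℝ} (h : RoundsTo a y) (ha : a = a') (hy : y = y') :
    RoundsTo a' y' := ha ▸ hy ▸ h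

open Classical in
/-- Each edge `e` can be assigned a set of `p e` of the `n` new vertices so that degrees and
multiplicities are shared evenly and every colour with enough incidences becomes linked. -/
theorem exists_even_split {E : Type*} {C : Type} [Fintype E] (n : ℕ) (col : E → C) (p : E → ℕ)
    {κ : Type*} {W : Type*} (X : E → κ) (w : E → W)
    (hw : ∀ e e', w e = w e' → col e = col e') (hp : ∀ e, p e ≤ n) :
    ∃ A : E → Finset (Fin n), (∀ e, (A e).card = p e) ∧
      (∀ i c, RoundsTo (((Finset.univ.filter (Sel col c)).filter fun e => i ∈ A e).card : ℝ)
        (((∑ e with Sel col c e, p e : ℕ) : ℝ) / (n : ℝ))) ∧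
      (∀ U x c, RoundsTo ((Finset.univ.filter fun e => A e = U ∧ X e = x ∧ Sel col c e).card : ℝ)
        (((Finset.univ.filter fun e => p e = U.card ∧ X e = x ∧ Sel col c e).card : ℝ) /
          (n.choose U.card : ℕ))) ∧
      ∀ j, n + (colWings col p w j).card ≤ colDeg col p j + 1 → IsLinked col w A j := by
  -- Both label types change in the step: `κ` becomes `κ × Prop`, recording membership in `I` so
  -- that hit and unhit edges are shared out separately, and `W` becomes `C ⊕ W`, which stays in its
  -- universe because `C : Type`.
  induction n generalizing p κ W with
  | zero =>
    have hp0 : ∀ e, p e = 0 := fun e => Nat.le_zero.1 (hp e)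
    refine ⟨fun _ => ∅, fun e => by simp [hp0], fun i => i.elim0, fun U x c => ?_,
      fun j _ f _ i => i.elim0⟩
    have hU : U = ∅ := Finset.eq_empty_of_isEmpty U
    subst hU
    simp only [Finset.card_empty, hp0, Nat.choose_self, Nat.cast_one, div_one]
    constructor
    · exact le_of_eq (by simp)
    · exact le_of_eq (by simp)
  | succ n ih =>
    obtain ⟨I, hI, hIn, hdeg, hmult⟩ := exists_even_choice n col p X w hw hp
    obtain ⟨A, hA, hAdeg, hAmult, hAlink⟩ := ih (restWeight p I) (fun e => (X e, e ∈ I))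
      (restLabel col w I) (restLabel_color hw) (fun e => by
        have h1 := hp e
        -- Edges of full weight `n + 1` must be hit, for otherwise `n` vertices could not absorb the
        -- rest simply.
        have h2 := hIn e
        unfold restWeight
        split_ifs with h
        · omega
        · have : p e ≠ n + 1 := fun h' => h (h2 h')
          omega)
    refine ⟨extendSplit A I, fun e => ?_, fun i c => ?_, fun U x c => ?_, fun j hj => ?_⟩
    · have := hI e
      rw [card_extendSplit, hA, restWeight]
      split_ifs with h
      · have := hI e h
        omega
      · omega
    · have hc := hdeg _ (Or.inl ⟨c, rfl⟩)
      refine Fin.lastCases ?_ (fun i => ?_) i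
      · exact roundsTo_degree_last hc
      · exact roundsTo_degree_castSucc hI hc i (hAdeg i c)
    · obtain ⟨U, rfl | rfl⟩ := exists_eq_map_castSucc U
      · have h1 := hAmult U (x, False) c
        have h2 := hmult U.card x c
        rw [Finset.card_map]
        refine (roundsTo_mult_map (p := p) (I := I) (A := A) (q := fun e => X e = x ∧ Sel col c e) U
          ?_ ?_).congr (card_filter_cast_congr fun e => Iff.rfl)
          (congrArg (fun t : ℝ => t / _) (card_filter_cast_congr fun e => Iff.rfl))
        · refine h2.congr (card_filter_cast_congr fun e => by tauto)
            (congrArg (fun t : ℝ => t * _ / _) (card_filter_cast_congr fun e => Iff.rfl))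
        · refine h1.congr (card_filter_cast_congr fun e => ?_)
            (congrArg (fun t : ℝ => t / _) (card_filter_cast_congr fun e => ?_)) <;>
          · rw [Prod.mk.injEq, eq_iff_iff, iff_false]
            tauto
      · have h1 := hAmult U (x, True) c
        have h2 := hmult (U.card + 1) x c
        rw [Finset.card_insert_of_notMem (last_notMem_map _), Finset.card_map]
        refine (roundsTo_mult_insert (p := p) (I := I) (A := A) (q := fun e => X e = x ∧ Sel col c e) hI U
          ?_ ?_).congr (card_filter_cast_congr fun e => Iff.rfl)
          (congrArg (fun t : ℝ => t / _) (card_filter_cast_congr fun e => Iff.rfl))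
        · refine h2.congr (card_filter_cast_congr fun e => by tauto)
            (congrArg (fun t : ℝ => t * _ / _) (card_filter_cast_congr fun e => Iff.rfl))
        · refine h1.congr (card_filter_cast_congr fun e => ?_)
            (congrArg (fun t : ℝ => t / _) (card_filter_cast_congr fun e => ?_)) <;>
          · rw [Prod.mk.injEq, eq_iff_iff, iff_true]
            tauto
    · have hj' : n + (colWings col p w j).card ≤ colDeg col p j := by omega
      have hlink : IsLinked col (restLabel col w I) A j := by
        apply hAlink
        apply card_restWings_le hw hI _ hj'
        intro v
        apply hdeg
        exact Or.inr (Or.inr ⟨v, rfl⟩)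
      refine isLinked_extendSplit hw hlink fun hn => ?_
      obtain ⟨e, heI, hej, e', hee', hpos⟩ := exists_hit_wing hn hw hI hdeg hj'
      exact ⟨e, heI, hej, e', hee', Finset.card_pos.1 (by rw [hA]; exact hpos)⟩

end EdgeSplit

/-! ### Wings as classes of edges joined away from `α`. -/

namespace MultiHypergraph

theorem exists_adj_of_reachable_ne {V : Type*} {G : SimpleGraph V} {u v : V} (h : G.Reachable u v)
    (hne : u ≠ v) : ∃ x, G.Adj u x := by
  obtain ⟨p⟩ := h
  cases p with
  | nil => exact absurd rfl hne
  | cons h _ => exact ⟨_, h⟩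

theorem prop_of_reachable {V : Type*} {G : SimpleGraph V} {P : V → Prop}
    (hP : ∀ a b, G.Adj a b → P a → P b) {u v : V} (h : G.Reachable u v) (hu : P u) : P v := by
  obtain ⟨p⟩ := h
  induction p with
  | nil => exact hu
  | cons h _ ih => exact ih (hP _ _ h hu)

section Wings

variable {V E : Type*} (G : MultiHypergraph V E) (α : V)

/-- Two distinct vertices other than `α` are adjacent when they lie in a common edge. -/
def avoidGraph : SimpleGraph V where
  Adj u v := u ≠ v ∧ u ≠ α ∧ v ≠ α ∧ ∃ e, u ∈ G.ends e ∧ v ∈ G.ends e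
  symm := ⟨fun _ _ h => ⟨h.1.symm, h.2.2.1, h.2.1, h.2.2.2.imp fun _ he => ⟨he.2, he.1⟩⟩⟩
  loopless := ⟨fun _ h => h.1 rfl⟩

variable {G α}

theorem avoidGraph_reachable {e : E} {u v : V} (hu : u ∈ G.ends e) (hv : v ∈ G.ends e)
    (huα : u ≠ α) (hvα : v ≠ α) : (G.avoidGraph α).Reachable u v := by
  by_cases h : u = v
  · subst h
    exact SimpleGraph.Reachable.refl _
  · exact SimpleGraph.Adj.reachable ⟨h, huα, hvα, e, hu, hv⟩

theorem shadow_reachable {S : Set E} {e : E} (he : e ∈ S) {u v : V} (hu : u ∈ G.ends e)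
    (hv : v ∈ G.ends e) : (G.shadow S).Reachable u v := by
  by_cases h : u = v
  · subst h
    exact SimpleGraph.Reachable.refl _
  · exact SimpleGraph.Adj.reachable ⟨h, e, he, hu, hv⟩

variable (G α)

/-- The edges that are joined to `e₀` by a path avoiding `α`. -/
def wingOf (e₀ : E) : G.Sub where
  verts := {v | v = α ∨ v ≠ α ∧ ∃ u ∈ G.ends e₀, u ≠ α ∧ (G.avoidGraph α).Reachable u v}
  edges := {e | e = e₀ ∨ ∃ u ∈ G.ends e₀, u ≠ α ∧ ∃ v ∈ G.ends e, v ≠ α ∧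
    (G.avoidGraph α).Reachable u v}
  ends_mem := by
    intro e he v hv
    by_cases hvα : v = α
    · exact Or.inl hvα
    · rcases he with rfl | ⟨u, hu, huα, v', hv', hv'α, h⟩
      · exact Or.inr ⟨hvα, v, hv, hvα, SimpleGraph.Reachable.refl _⟩
      · exact Or.inr ⟨hvα, u, hu, huα, h.trans (avoidGraph_reachable hv' hv hv'α hvα)⟩

variable {G α}

theorem self_mem_wingOf_edges (e : E) : e ∈ (G.wingOf α e).edges := Or.inl rfl

theorem mem_wingOf_edges {e₀ e : E} {v : V} (hv : v ∈ G.ends e) (hvα : v ≠ α)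
    (h : v ∈ (G.wingOf α e₀).verts) : e ∈ (G.wingOf α e₀).edges := by
  rcases h with h | ⟨-, u, hu, huα, h⟩
  · exact absurd h hvα
  · exact Or.inr ⟨u, hu, huα, v, hv, hvα, h⟩

theorem wingOf_eq_of_mem {e₀ e : E} (h : e ∈ (G.wingOf α e₀).edges) :
    G.wingOf α e = G.wingOf α e₀ := by
  rcases h with rfl | ⟨u, hu, huα, v, hv, hvα, h⟩
  · rfl
  have key {x : V} : (∃ u ∈ G.ends e, u ≠ α ∧ (G.avoidGraph α).Reachable u x) ↔
      ∃ u ∈ G.ends e₀, u ≠ α ∧ (G.avoidGraph α).Reachable u x := by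
    constructor
    · rintro ⟨v', hv', hv'α, h'⟩
      exact ⟨u, hu, huα, h.trans ((avoidGraph_reachable hv hv' hvα hv'α).trans h')⟩
    · rintro ⟨u', hu', hu'α, h'⟩
      exact ⟨v, hv, hvα, h.symm.trans ((avoidGraph_reachable hu hu' huα hu'α).trans h')⟩
  apply Sub.ext
  · ext x
    simp only [wingOf, Set.mem_ofPred_eq, key]
  · ext a
    have key' : (∃ u ∈ G.ends e, u ≠ α ∧ ∃ v ∈ G.ends a, v ≠ α ∧ (G.avoidGraph α).Reachable u v) ↔
        ∃ u ∈ G.ends e₀, u ≠ α ∧ ∃ v ∈ G.ends a, v ≠ α ∧ (G.avoidGraph α).Reachable u v := by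
      constructor
      · rintro ⟨u', hu', hu'α, v', hv', hv'α, h'⟩
        obtain ⟨x, hx, hxα, hx'⟩ := key.1 ⟨u', hu', hu'α, h'⟩
        exact ⟨x, hx, hxα, v', hv', hv'α, hx'⟩
      · rintro ⟨u', hu', hu'α, v', hv', hv'α, h'⟩
        obtain ⟨x, hx, hxα, hx'⟩ := key.2 ⟨u', hu', hu'α, h'⟩
        exact ⟨x, hx, hxα, v', hv', hv'α, hx'⟩
    simp only [wingOf, Set.mem_ofPred_eq, key']
    constructor
    · rintro (rfl | h')
      · exact Or.inr ⟨u, hu, huα, v, hv, hvα, h⟩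
      · exact Or.inr h'
    · rintro (rfl | h')
      · exact Or.inr ⟨u, hu, huα, u, hu, huα, SimpleGraph.Reachable.refl _⟩
      · exact Or.inr h'

theorem wingOf_eq_iff {e e' : E} : G.wingOf α e = G.wingOf α e' ↔ e ∈ (G.wingOf α e').edges :=
  ⟨fun h => h ▸ self_mem_wingOf_edges e, wingOf_eq_of_mem⟩

theorem wingOf_reachable {e₀ : E} {u v : V} (hu : u ∈ (G.wingOf α e₀).verts)
    (h : (G.avoidGraph α).Reachable u v) : (G.shadow (G.wingOf α e₀).edges).Reachable u v := by
  refine (prop_of_reachable (P := fun v => v ∈ (G.wingOf α e₀).verts ∧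
    (G.shadow (G.wingOf α e₀).edges).Reachable u v) ?_ h ⟨hu, SimpleGraph.Reachable.refl _⟩).2
  rintro a b ⟨-, ha, -, e, hae, hbe⟩ ⟨hav, hr⟩
  have he := mem_wingOf_edges hae ha hav
  exact ⟨(G.wingOf α e₀).ends_mem e he b hbe, hr.trans (shadow_reachable he hae hbe)⟩

/-- A path avoiding `α` between edges of the two sides never leaves the first side, since the sides
share only `α`; its endpoint would then be a second common vertex. -/
theorem not_isCutVertex_wingOf (e₀ : E) : ¬ (G.wingOf α e₀).IsCutVertex α := by
  rintro ⟨I, J, ⟨a, ha⟩, ⟨b, hb⟩, -, hE, hIJv, hIJe⟩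
  have ha' : a ∈ (G.wingOf α e₀).edges := hE ▸ Or.inl ha
  have hb' : b ∈ (G.wingOf α e₀).edges := hE ▸ Or.inr hb
  have hab : ¬ (a = e₀ ∧ b = e₀) := by
    rintro ⟨h1, h2⟩
    have hmem : a ∈ I.edges ∩ J.edges := ⟨ha, by rw [h1, ← h2]; exact hb⟩
    rw [hIJe] at hmem
    exact hmem
  -- If `e₀` had no vertex other than `α`, it would be the only edge of its class, and two disjoint
  -- nonempty edge sets could not fit.
  obtain ⟨u, hu, huα⟩ : ∃ u ∈ G.ends e₀, u ≠ α := by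
    rcases ha' with rfl | ⟨u, hu, huα, -⟩
    · rcases hb' with rfl | ⟨u, hu, huα, -⟩
      · exact absurd ⟨rfl, rfl⟩ hab
      · exact ⟨u, hu, huα⟩
    · exact ⟨u, hu, huα⟩
  have touch : ∀ e ∈ (G.wingOf α e₀).edges, ∃ v ∈ G.ends e, v ≠ α ∧
      (G.avoidGraph α).Reachable u v := by
    rintro e (rfl | ⟨u', hu', hu'α, v, hv, hvα, h⟩)
    · exact ⟨u, hu, huα, SimpleGraph.Reachable.refl _⟩
    · exact ⟨v, hv, hvα, (avoidGraph_reachable hu hu' huα hu'α).trans h⟩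
  have both : ∀ v, v ∈ I.verts → v ∈ J.verts → v = α := fun v h1 h2 =>
    (hIJv ▸ (⟨h1, h2⟩ : v ∈ I.verts ∩ J.verts) : v ∈ ({α} : Set V))
  obtain ⟨x, hxa, hxα, hux⟩ := touch a ha'
  obtain ⟨y, hyb, hyα, huy⟩ := touch b hb'
  have hyI : y ∈ (G.wingOf α e₀).verts ∧ y ∈ I.verts := by
    refine prop_of_reachable (P := fun v => v ∈ (G.wingOf α e₀).verts ∧ v ∈ I.verts) ?_
      (hux.symm.trans huy) ⟨Sub.ends_mem _ a ha' x hxa, I.ends_mem a ha x hxa⟩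
    rintro c d ⟨-, hc, -, e, hce, hde⟩ ⟨hcv, hcI⟩
    have he := mem_wingOf_edges hce hc hcv
    refine ⟨Sub.ends_mem _ e he d hde, ?_⟩
    rcases (hE.symm ▸ he : e ∈ I.edges ∪ J.edges) with heI | heJ
    · exact I.ends_mem e heI d hde
    · exact absurd (both c hcI (J.ends_mem e heJ c hce)) hc
  exact hyα (both y hyI.2 (J.ends_mem b hb y hyb))

theorem isWing_wingOf {e₀ : E} (h₀ : α ∈ G.ends e₀) : (G.wingOf α e₀).IsWing α where
  mem := Or.inl rfl
  nontrivial := ⟨e₀, self_mem_wingOf_edges e₀⟩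
  connected := by
    have toα : ∀ v ∈ (G.wingOf α e₀).verts,
        (G.shadow (G.wingOf α e₀).edges).Reachable v α := by
      rintro v (rfl | ⟨hvα, u, hu, huα, h⟩)
      · exact SimpleGraph.Reachable.refl _
      · exact (wingOf_reachable ((G.wingOf α e₀).ends_mem e₀ (self_mem_wingOf_edges e₀) u hu)
          h).symm.trans (shadow_reachable (self_mem_wingOf_edges e₀) hu h₀)
    refine ⟨⟨α, Or.inl rfl⟩, fun u hu v hv => (toα u hu).trans (toα v hv).symm, ?_⟩
    rintro e (rfl | ⟨-, -, -, v, hv, -⟩) h0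
    · rw [h0] at h₀
      exact Multiset.notMem_zero _ h₀
    · rw [h0] at hv
      exact Multiset.notMem_zero _ hv
  not_cut := not_isCutVertex_wingOf e₀
  closed := by
    intro e he v hv hvW
    by_contra hvα
    exact he (mem_wingOf_edges hv hvα hvW)

theorem Sub.IsWing.exists_edge_mem {W : G.Sub} (hW : W.IsWing α) : ∃ e ∈ W.edges, α ∈ G.ends e := by
  obtain ⟨e, he⟩ := hW.nontrivial
  obtain ⟨v, hv⟩ := Multiset.exists_mem_of_ne_zero (hW.connected.2.2 e he)
  by_cases hvα : v = α
  · exact ⟨e, he, hvα ▸ hv⟩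
  · obtain ⟨x, -, e', he', hα, -⟩ := exists_adj_of_reachable_ne
      (hW.connected.2.1 α hW.mem v (W.ends_mem e he v hv)) (Ne.symm hvα)
    exact ⟨e', he', hα⟩

/-- Closedness makes `W` contain everything joined to `e₀` away from `α`. Any further edge would
split `W` at `α` into this class and the remainder. -/
theorem Sub.IsWing.eq_wingOf {W : G.Sub} (hW : W.IsWing α) {e₀ : E} (h₀ : e₀ ∈ W.edges) :
    W = G.wingOf α e₀ := by
  have mem_edges {e : E} {v : V} (hv : v ∈ G.ends e) (hvα : v ≠ α) (hvW : v ∈ W.verts) :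
      e ∈ W.edges := by
    by_contra he
    exact hvα (hW.closed e he v hv hvW)
  have hverts : ∀ u ∈ G.ends e₀, ∀ v, (G.avoidGraph α).Reachable u v → v ∈ W.verts := by
    intro u hu v h
    refine prop_of_reachable (P := fun v => v ∈ W.verts) ?_ h (W.ends_mem e₀ h₀ u hu)
    rintro a b ⟨-, ha, -, e, hae, hbe⟩ haW
    exact W.ends_mem e (mem_edges hae ha haW) b hbe
  have hV : (G.wingOf α e₀).verts ⊆ W.verts := by
    rintro v (rfl | ⟨-, u, hu, -, h⟩)
    · exact hW.mem
    · exact hverts u hu v h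
  have hE : (G.wingOf α e₀).edges ⊆ W.edges := by
    rintro e (rfl | ⟨u, hu, -, v, hv, hvα, h⟩)
    · exact h₀
    · exact mem_edges hv hvα (hverts u hu v h)
  have hE' : W.edges ⊆ (G.wingOf α e₀).edges := by
    intro e he
    by_contra hne
    refine hW.not_cut ⟨G.wingOf α e₀,
      { verts := {v | v ∈ W.verts ∧ (v ∈ (G.wingOf α e₀).verts → v = α)}
        edges := W.edges \ (G.wingOf α e₀).edges
        ends_mem := ?_ }, ⟨e₀, self_mem_wingOf_edges e₀⟩, ⟨e, he, hne⟩, ?_, ?_, ?_, ?_⟩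
    · rintro a ⟨haW, ha⟩ v hv
      refine ⟨W.ends_mem a haW v hv, fun hvW => ?_⟩
      by_contra hvα
      exact ha (mem_wingOf_edges hv hvα hvW)
    · ext v
      simp only [Set.mem_union, Set.mem_ofPred_eq]
      constructor
      · rintro (h | h)
        · exact hV h
        · exact h.1
      · intro h
        by_cases hv : v ∈ (G.wingOf α e₀).verts
        · exact Or.inl hv
        · exact Or.inr ⟨h, fun h' => absurd h' hv⟩
    · exact Set.union_sdiff_cancel hE
    · ext v
      simp only [Set.mem_inter_iff, Set.mem_ofPred_eq, Set.mem_singleton_iff]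
      constructor
      · rintro ⟨h1, -, h2⟩
        exact h2 h1
      · rintro rfl
        exact ⟨Or.inl rfl, hW.mem, fun _ => rfl⟩
    · exact Set.inter_sdiff_self _ _
  apply Sub.ext
  · refine Set.Subset.antisymm (fun v hv => ?_) hV
    by_cases hvα : v = α
    · exact Or.inl hvα
    · obtain ⟨x, -, e, he, hve, -⟩ := exists_adj_of_reachable_ne
        (hW.connected.2.1 v hv α hW.mem) hvα
      exact (G.wingOf α e₀).ends_mem e (hE' he) v hve
  · exact Set.Subset.antisymm hE' hE

/-- Wings can thus be counted as the classes of the edges through `α`. -/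
theorem setOf_isWing : {W : G.Sub | W.IsWing α} = G.wingOf α '' {e | α ∈ G.ends e} := by
  ext W
  constructor
  · intro hW
    obtain ⟨e, he, hα⟩ := Sub.IsWing.exists_edge_mem hW
    exact ⟨e, hα, (Sub.IsWing.eq_wingOf hW he).symm⟩
  · rintro ⟨e, he, rfl⟩
    exact isWing_wingOf he

end Wings

/-! ### Components of a detachment. -/

section Components

variable {V E : Type*} {α : V} {n : ℕ} {G : MultiHypergraph V E}
  {F : MultiHypergraph (SplitVertex V α n) E}

theorem IsDetachment.mem_ends (hF : F.IsDetachment G) {e : E} {v : V} :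
    v ∈ G.ends e ↔ ∃ x ∈ F.ends e, merge α n x = v := by
  rw [← hF e, Multiset.mem_map]

theorem IsDetachment.inl_mem_ends (hF : F.IsDetachment G) {e : E} {v : {v : V // v ≠ α}} :
    Sum.inl v ∈ F.ends e ↔ v.1 ∈ G.ends e := by
  rw [hF.mem_ends]
  constructor
  · intro h
    exact ⟨_, h, rfl⟩
  · rintro ⟨x | i, hx, h⟩
    · have : x = v := Subtype.ext h
      exact this ▸ hx
    · exact absurd h.symm v.2

theorem IsDetachment.reachable_merge (hF : F.IsDetachment G) {x y : SplitVertex V α n}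
    (h : (F.shadow Set.univ).Reachable x y) :
    (G.shadow Set.univ).Reachable (merge α n x) (merge α n y) := by
  refine prop_of_reachable (P := fun y => (G.shadow Set.univ).Reachable (merge α n x)
    (merge α n y)) ?_ h (SimpleGraph.Reachable.refl _)
  rintro a b ⟨-, e, he, ha, hb⟩ hr
  exact hr.trans (shadow_reachable he (hF.mem_ends.2 ⟨a, ha, rfl⟩) (hF.mem_ends.2 ⟨b, hb, rfl⟩))

/-- Every edge of a path lifts, and consecutive lifts can be joined because any two preimages of a
vertex are connected. -/
theorem IsDetachment.reachable_of_merge (hF : F.IsDetachment G)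
    (h : ∀ i i', (F.shadow Set.univ).Reachable (Sum.inr i) (Sum.inr i'))
    {x y : SplitVertex V α n}
    (hxy : (G.shadow Set.univ).Reachable (merge α n x) (merge α n y)) :
    (F.shadow Set.univ).Reachable x y := by
  have same : ∀ x y : SplitVertex V α n, merge α n x = merge α n y →
      (F.shadow Set.univ).Reachable x y := by
    rintro (x | i) (y | i') hm
    · have : x = y := Subtype.ext hm
      rw [this]
    · exact absurd hm x.2
    · exact absurd hm.symm y.2
    · exact h i i'
  refine prop_of_reachable (P := fun v => ∀ y, merge α n y = v →
    (F.shadow Set.univ).Reachable x y) ?_ hxy (fun y hy => same x y hy.symm) y rfl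
  rintro a b ⟨-, e, he, ha, hb⟩ hr y hy
  obtain ⟨a', ha', rfl⟩ := hF.mem_ends.1 ha
  obtain ⟨b', hb', rfl⟩ := hF.mem_ends.1 hb
  exact (hr a' rfl).trans ((shadow_reachable he ha' hb').trans (same b' y hy.symm))

/-- Merging induces a surjection of finite sets of components, so equal cardinality means
injectivity, which can only fail at the new vertices. Surjectivity over `α` uses `0 < n`. -/
theorem IsDetachment.numComponents_eq_iff [Finite V] (hF : F.IsDetachment G) (hn : 0 < n) :
    F.numComponents = G.numComponents ↔
      ∀ i i', (F.shadow Set.univ).Reachable (Sum.inr i) (Sum.inr i') := by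
  let φ : (F.shadow Set.univ).ConnectedComponent → (G.shadow Set.univ).ConnectedComponent :=
    Quot.map (merge α n) fun _ _ h => hF.reachable_merge h
  have hφ (x : SplitVertex V α n) : φ ((F.shadow Set.univ).connectedComponentMk x) =
      (G.shadow Set.univ).connectedComponentMk (merge α n x) := rfl
  have hsurj : Function.Surjective φ := by
    intro c
    induction c using SimpleGraph.ConnectedComponent.ind with
    | _ v =>
      by_cases hv : v = α
      · exact ⟨(F.shadow Set.univ).connectedComponentMk (Sum.inr ⟨0, hn⟩), by rw [hφ, hv]; rfl⟩
      · exact ⟨(F.shadow Set.univ).connectedComponentMk (Sum.inl ⟨v, hv⟩), by rw [hφ]; rfl⟩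
  have : Finite (F.shadow Set.univ).ConnectedComponent := Quot.finite _
  have : Finite (G.shadow Set.univ).ConnectedComponent := Quot.finite _
  constructor
  · intro h i i'
    have hbij := (Nat.bijective_iff_surjective_and_card φ).2 ⟨hsurj, h⟩
    exact SimpleGraph.ConnectedComponent.exact (hbij.1 (a₁ := (F.shadow Set.univ).connectedComponentMk
      (Sum.inr i)) (a₂ := (F.shadow Set.univ).connectedComponentMk (Sum.inr i')) rfl)
  · intro h
    refine Nat.card_eq_of_bijective φ ⟨fun c d => ?_, hsurj⟩
    induction c using SimpleGraph.ConnectedComponent.ind with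
    | _ x =>
      induction d using SimpleGraph.ConnectedComponent.ind with
      | _ y =>
        rw [hφ, hφ, SimpleGraph.ConnectedComponent.eq, SimpleGraph.ConnectedComponent.eq]
        exact hF.reachable_of_merge h

theorem IsDetachment.reachable_inl (hF : F.IsDetachment G) {u v : V} (hu : u ≠ α) (hv : v ≠ α)
    (h : (G.avoidGraph α).Reachable u v) :
    (F.shadow Set.univ).Reachable (Sum.inl ⟨u, hu⟩) (Sum.inl ⟨v, hv⟩) := by
  refine prop_of_reachable (P := fun v => ∀ hv : v ≠ α,
    (F.shadow Set.univ).Reachable (Sum.inl ⟨u, hu⟩) (Sum.inl ⟨v, hv⟩)) ?_ h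
    (fun _ => SimpleGraph.Reachable.refl _) hv
  rintro a b ⟨-, ha, -, e, hae, hbe⟩ hr hb
  exact (hr ha).trans (shadow_reachable (Set.mem_univ e) (hF.inl_mem_ends.2 hae)
    (hF.inl_mem_ends.2 hbe))

/-- The new vertices lie in one component exactly when they are linked through wings. -/
theorem IsDetachment.reachable_inr_iff (hF : F.IsDetachment G) :
    (∀ i i', (F.shadow Set.univ).Reachable (Sum.inr i) (Sum.inr i')) ↔
      ∀ f : Fin n → Prop, (∀ e e', G.wingOf α e = G.wingOf α e' → ∀ i, Sum.inr i ∈ F.ends e →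
        ∀ i', Sum.inr i' ∈ F.ends e' → (f i ↔ f i')) → ∀ i i', f i ↔ f i' := by
  constructor
  · intro h f hf i i'
    -- An old vertex takes the value true when its wing meets a new vertex where `f` is true; this
    -- makes `g` invariant along edges.
    let g : SplitVertex V α n → Prop := Sum.elim
      (fun v => ∃ e, v.1 ∈ (G.wingOf α e).verts ∧ ∃ i, Sum.inr i ∈ F.ends e ∧ f i) f
    have hg : ∀ x y, (F.shadow Set.univ).Adj x y → g x → g y := by
      rintro (x | i) (y | i') ⟨-, e', -, hx, hy⟩ hgx
      · obtain ⟨e, hxe, hi⟩ := hgx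
        have he := mem_wingOf_edges (hF.inl_mem_ends.1 hx) x.2 hxe
        exact ⟨e, Sub.ends_mem _ e' he _ (hF.inl_mem_ends.1 hy), hi⟩
      · obtain ⟨e, hxe, i, hi, hfi⟩ := hgx
        have he := mem_wingOf_edges (hF.inl_mem_ends.1 hx) x.2 hxe
        exact (hf e e' (wingOf_eq_of_mem he).symm i hi i' hy).1 hfi
      · exact ⟨e', Sub.ends_mem _ e' (self_mem_wingOf_edges e') _ (hF.inl_mem_ends.1 hy), i, hx,
          hgx⟩
      · exact (hf e' e' rfl i hx i' hy).1 hgx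
    exact ⟨fun hi => prop_of_reachable hg (h i i') hi, fun hi => prop_of_reachable hg (h i' i) hi⟩
  · intro h i₀ i₁
    refine (h (fun i => (F.shadow Set.univ).Reachable (Sum.inr i₀) (Sum.inr i)) ?_ i₀ i₁).1
      (SimpleGraph.Reachable.refl _)
    intro e e' hw i hi i' hi'
    have hr : (F.shadow Set.univ).Reachable (Sum.inr i) (Sum.inr i') := by
      rcases wingOf_eq_iff.1 hw with rfl | ⟨u, hu, huα, v, hv, hvα, hr⟩
      · exact shadow_reachable (Set.mem_univ e) hi hi'
      · exact (shadow_reachable (Set.mem_univ e) hi (hF.inl_mem_ends (v := ⟨v, hvα⟩).2 hv)).trans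
          ((hF.reachable_inl hvα huα hr.symm).trans (shadow_reachable (Set.mem_univ e')
            (hF.inl_mem_ends (v := ⟨u, huα⟩).2 hu) hi'))
    exact ⟨fun h => h.trans hr, fun h => h.trans hr.symm⟩

end Components

end MultiHypergraph

/-! ### Necessity of the inequality. -/

namespace EdgeSplit
open Classical

/-- Linkedness makes the bipartite graph of new vertices and wings connected, and a connected graph
has at most one vertex more than it has edges. -/
theorem IsLinked.card_le {E C W : Type*} [Fintype E] {n : ℕ} (hn : 0 < n) {col : E → C} {p : E → ℕ}
    {w : E → W} {A : E → Finset (Fin n)} (hA : ∀ e, (A e).card = p e) {j : C}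
    (h : IsLinked col w A j) : n + (colWings col p w j).card ≤ colDeg col p j + 1 := by
  let T := {x : E × Fin n // col x.1 = j ∧ x.2 ∈ A x.1}
  let N := Fin n ⊕ {v // v ∈ colWings col p w j}
  have hlab (x : T) : w x.1.1 ∈ colWings col p w j :=
    mem_colWings.2 ⟨x.1.1, x.2.1, by rw [← hA]; exact Finset.card_pos.2 ⟨_, x.2.2⟩, rfl⟩
  -- Several incidences may give the same edge; only the bound of the number of edges by the number
  -- of incidences matters.
  let m : T → Sym2 N := fun x => s(Sum.inl x.1.2, Sum.inr ⟨w x.1.1, hlab x⟩)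
  let B : SimpleGraph N := SimpleGraph.fromEdgeSet (Set.range m)
  have hadj (x : T) : B.Adj (Sum.inl x.1.2) (Sum.inr ⟨w x.1.1, hlab x⟩) := by
    rw [SimpleGraph.fromEdgeSet_adj]
    exact ⟨⟨x, rfl⟩, by simp⟩
  have hinl : ∀ i, B.Reachable (Sum.inl ⟨0, hn⟩) (Sum.inl i) := by
    intro i
    refine (h (fun i => B.Reachable (Sum.inl ⟨0, hn⟩) (Sum.inl i)) ?_ ⟨0, hn⟩ i).1
      (SimpleGraph.Reachable.refl _)
    intro e e' he he' hw i hi i' hi'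
    have h1 := (hadj ⟨(e, i), he, hi⟩).reachable
    have h2 := (hadj ⟨(e', i'), he', hi'⟩).reachable
    simp only [← hw] at h2
    have := h1.trans h2.symm
    exact ⟨fun h => h.trans this, fun h => h.trans this.symm⟩
  have hroot : ∀ x, B.Reachable (Sum.inl ⟨0, hn⟩) x := by
    rintro (i | ⟨v, hv⟩)
    · exact hinl i
    · obtain ⟨e, he, hp, rfl⟩ := mem_colWings.1 hv
      obtain ⟨i, hi⟩ := Finset.card_pos.1 ((hA e).symm ▸ hp)
      exact (hinl i).trans (hadj ⟨(e, i), he, hi⟩).reachable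
  have hconn : B.Connected :=
    { preconnected := fun x y => (hroot x).symm.trans (hroot y)
      nonempty := ⟨Sum.inl ⟨0, hn⟩⟩ }
  have h1 := hconn.card_vert_le_card_edgeSet_add_one
  have h2 : Nat.card B.edgeSet ≤ Nat.card T := by
    have hsub : B.edgeSet ⊆ Set.range m := by
      rw [SimpleGraph.edgeSet_fromEdgeSet]
      exact Set.sdiff_subset
    exact (Nat.card_mono (Set.finite_range m) hsub).trans (Finite.card_range_le m)
  have h3 : Nat.card T = colDeg col p j := by
    rw [Nat.card_eq_fintype_card, Fintype.card_subtype, Finset.card_filter, Fintype.sum_prod_type,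
      colDeg, Finset.sum_filter]
    refine Finset.sum_congr rfl fun e _ => ?_
    rw [← Finset.card_filter]
    split_ifs with hj
    · simp [hj, hA]
    · simp [hj]
  have h4 : Nat.card N = n + (colWings col p w j).card := by
    simp [N]
  omega

end EdgeSplit

/-! ### Translation between splits and detachments, and the theorem. -/

namespace MultiHypergraph

theorem count_inr_splitEdge {V : Type*} [DecidableEq V] {α : V} {n : ℕ} (U : Finset (Fin n))
    (X : Multiset {v : V // v ≠ α}) (i : Fin n) :
    (splitEdge U X).count (Sum.inr i) = if i ∈ U then 1 else 0 := by
  rw [splitEdge, Multiset.count_add, Multiset.count_map_eq_count' _ _ Sum.inr_injective,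
    Multiset.count_eq_zero_of_notMem (s := X.map Sum.inl) (by simp), add_zero]
  split_ifs with h
  · exact Multiset.count_eq_one_of_mem U.nodup h
  · exact Multiset.count_eq_zero_of_notMem h

theorem count_inl_splitEdge {V : Type*} [DecidableEq V] {α : V} {n : ℕ} (U : Finset (Fin n))
    (X : Multiset {v : V // v ≠ α}) (v : {v : V // v ≠ α}) :
    (splitEdge U X).count (Sum.inl v) = X.count v := by
  rw [splitEdge, Multiset.count_add, Multiset.count_map_eq_count' _ _ Sum.inl_injective,
    Multiset.count_eq_zero_of_notMem (s := U.val.map Sum.inr) (by simp), zero_add]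

theorem inr_mem_splitEdge {V : Type*} {α : V} {n : ℕ} {U : Finset (Fin n)}
    {X : Multiset {v : V // v ≠ α}} {i : Fin n} : Sum.inr i ∈ splitEdge U X ↔ i ∈ U := by
  simp [splitEdge]

theorem splitEdge_inj {V : Type*} {α : V} {n : ℕ} {U U' : Finset (Fin n)}
    {X X' : Multiset {v : V // v ≠ α}} : splitEdge U X = splitEdge U' X' ↔ U = U' ∧ X = X' := by
  classical
  constructor
  · intro h
    constructor
    · ext i
      rw [← inr_mem_splitEdge (X := X), h, inr_mem_splitEdge]
    · ext v
      rw [← count_inl_splitEdge U, h, count_inl_splitEdge]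
  · rintro ⟨rfl, rfl⟩
    rfl

theorem replicate_add_map_val_inj {V : Type*} {α : V} {t t' : ℕ}
    {X X' : Multiset {v : V // v ≠ α}} :
    Multiset.replicate t α + X.map Subtype.val = Multiset.replicate t' α + X'.map Subtype.val ↔
      t = t' ∧ X = X' := by
  classical
  have hα (t : ℕ) (X : Multiset {v : V // v ≠ α}) :
      (Multiset.replicate t α + X.map Subtype.val).count α = t := by
    rw [Multiset.count_add, Multiset.count_replicate_self,
      Multiset.count_eq_zero_of_notMem (s := X.map Subtype.val) (by simp), add_zero]
  constructor
  · intro h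
    have ht : t = t' := by rw [← hα t X, h, hα]
    subst ht
    exact ⟨rfl, Multiset.map_injective Subtype.val_injective (add_left_cancel h)⟩
  · rintro ⟨rfl, rfl⟩
    rfl

theorem exists_eq_replicate_add {V : Type*} [DecidableEq V] (α : V) (s : Multiset V) :
    ∃ X : Multiset {v : V // v ≠ α},
      s = Multiset.replicate (s.count α) α + X.map Subtype.val := by
  refine ⟨(s.filter (· ≠ α)).pmap Subtype.mk fun v hv => (Multiset.mem_filter.1 hv).2, ?_⟩
  rw [Multiset.map_pmap, Multiset.pmap_eq_map, Multiset.map_id', ← Multiset.filter_eq',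
    Multiset.filter_add_not]

theorem map_merge_splitEdge {V : Type*} {α : V} {n : ℕ} (U : Finset (Fin n))
    (X : Multiset {v : V // v ≠ α}) :
    (splitEdge U X).map (merge α n) = Multiset.replicate U.card α + X.map Subtype.val := by
  rw [splitEdge, Multiset.map_add, Multiset.map_map, Multiset.map_map]
  congr 1
  exact Multiset.map_const' _ _

theorem isSimpleAt_of_count_le_one {V E : Type*} [DecidableEq V] [Fintype E]
    {G : MultiHypergraph V E} {v : V} (h : ∀ e, (G.ends e).count v ≤ 1) : G.IsSimpleAt v := by
  intro X
  rw [mult, Finset.card_eq_zero, Finset.filter_eq_empty_iff]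
  intro e _ he
  have := h e
  rw [he, Multiset.count_add, Multiset.count_replicate_self] at this
  omega

open Classical in
theorem mult_colorClass {V E C : Type*} [DecidableEq V] [Fintype E] (G : MultiHypergraph V E)
    (col : E → C) (j : C) [Fintype {e : E // col e = j}] (X : Multiset V) :
    (G.colorClass col j).mult X = (Finset.univ.filter fun e => G.ends e = X ∧ col e = j).card := by
  rw [mult]
  refine Finset.card_bij (fun e _ => e.1) ?_ ?_ ?_
  · intro e he
    simp only [Finset.mem_filter, Finset.mem_univ, true_and] at he ⊢
    exact ⟨he, e.2⟩
  · intro a _ b _ h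
    exact Subtype.ext h
  · intro e he
    simp only [Finset.mem_filter, Finset.mem_univ, true_and] at he
    exact ⟨⟨e, he.2⟩, Finset.mem_filter.2 ⟨Finset.mem_univ _, he.1⟩, rfl⟩

open Classical in
theorem degree_colorClass {V E C : Type*} [DecidableEq V] [Fintype E] (G : MultiHypergraph V E)
    (col : E → C) (j : C) [Fintype {e : E // col e = j}] (v : V) :
    (G.colorClass col j).degree v = ∑ e with col e = j, (G.ends e).count v := by
  rw [degree]
  exact (Finset.sum_subtype _ (by simp) fun e => (G.ends e).count v).symm

/-- The wing of an edge in its colour class. -/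
def colorWing {V E C : Type*} (G : MultiHypergraph V E) (α : V) (col : E → C) (e : E) :
    Σ j, (G.colorClass col j).Sub :=
  ⟨col e, (G.colorClass col (col e)).wingOf α ⟨e, rfl⟩⟩

theorem colorWing_eq {V E C : Type*} {G : MultiHypergraph V E} {α : V} {col : E → C} {e : E} {j : C}
    (h : col e = j) : G.colorWing α col e = ⟨j, (G.colorClass col j).wingOf α ⟨e, h⟩⟩ := by
  subst h
  rfl

theorem numWings_colorClass {V E C : Type*} [DecidableEq V] [Fintype E] (G : MultiHypergraph V E)
    (α : V) (col : E → C) (j : C) :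
    (G.colorClass col j).numWings α = (EdgeSplit.colWings col (fun e => (G.ends e).count α)
      (G.colorWing α col) j).card := by
  rw [numWings, setOf_isWing, ← Set.ncard_image_of_injective _ (sigma_mk_injective (β := fun j => (G.colorClass col j).Sub) (i := j)),
    ← Set.ncard_coe_finset]
  congr 1
  ext w
  simp only [Finset.mem_coe, EdgeSplit.mem_colWings, Multiset.count_pos, Set.mem_image]
  constructor
  · rintro ⟨_, ⟨e, he, rfl⟩, rfl⟩
    exact ⟨e.1, e.2, he, colorWing_eq e.2⟩
  · rintro ⟨e, hj, he, rfl⟩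
    exact ⟨_, ⟨⟨e, hj⟩, he, rfl⟩, (colorWing_eq hj).symm⟩

/-- The detachment in which the occurrences of `α` in `e` are replaced by the set `A e`. -/
def ofSplit {V E : Type*} {α : V} {n : ℕ} (A : E → Finset (Fin n))
    (X : E → Multiset {v : V // v ≠ α}) : MultiHypergraph (SplitVertex V α n) E where
  ends e := splitEdge (A e) (X e)

theorem isLinked_iff_forall_reachable {V E C : Type*} {G : MultiHypergraph V E} {α : V} {n : ℕ}
    {A : E → Finset (Fin n)} {X : E → Multiset {v : V // v ≠ α}} (col : E → C) (j : C)
    (hF : (ofSplit A X).IsDetachment G) :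
    EdgeSplit.IsLinked col (G.colorWing α col) A j ↔
      ∀ i i', (((ofSplit A X).colorClass col j).shadow Set.univ).Reachable
        (Sum.inr i) (Sum.inr i') := by
  have hF' : ((ofSplit A X).colorClass col j).IsDetachment (G.colorClass col j) := fun e => hF e.1
  rw [hF'.reachable_inr_iff]
  refine forall_congr' fun f => imp_congr_left ⟨fun h e e' hw i hi i' hi' => ?_,
    fun h e e' he he' hw i hi i' hi' => ?_⟩
  · refine h e.1 e'.1 e.2 e'.2 ?_ i (inr_mem_splitEdge.1 hi) i' (inr_mem_splitEdge.1 hi')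
    rw [colorWing_eq e.2, colorWing_eq e'.2]
    exact congrArg (Sigma.mk j) hw
  · rw [colorWing_eq he, colorWing_eq he'] at hw
    exact h ⟨e, he⟩ ⟨e', he'⟩ (sigma_mk_injective (β := fun j => (G.colorClass col j).Sub) hw) i (inr_mem_splitEdge.2 hi) i'
      (inr_mem_splitEdge.2 hi')

end MultiHypergraph

theorem theorem1 {V E : Type*} [Fintype V] [DecidableEq V] [Fintype E]
    (k n : ℕ) (hk : 0 < k) (hn : 0 < n)
    (H : MultiHypergraph V E) (col : E → Fin k) (α : V)
    (hα : ∀ t : ℕ, n < t → ∀ Y : Multiset V, H.mult (Multiset.replicate t α + Y) = 0) :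
    ∃ F : MultiHypergraph (MultiHypergraph.SplitVertex V α n) E,
      F.IsDetachment H ∧
      (∀ i : Fin n, F.IsSimpleAt (Sum.inr i)) ∧
      -- degrees are shared evenly
      (∀ i : Fin n, RoundsTo (F.degree (Sum.inr i)) (H.degree α / n)) ∧
      -- degrees are shared evenly within each colour class
      (∀ (i : Fin n) (j : Fin k),
        RoundsTo ((F.colorClass col j).degree (Sum.inr i))
          ((H.colorClass col j).degree α / n)) ∧
      -- multiplicities are shared evenly
      (∀ (U : Finset (Fin n)) (X : Multiset {v : V // v ≠ α}),
        RoundsTo (F.mult (MultiHypergraph.splitEdge U X))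
          (H.mult (Multiset.replicate U.card α + X.map Subtype.val) / n.choose U.card)) ∧
      -- multiplicities are shared evenly within each colour class
      (∀ (U : Finset (Fin n)) (X : Multiset {v : V // v ≠ α}) (j : Fin k),
        RoundsTo ((F.colorClass col j).mult (MultiHypergraph.splitEdge U X))
          ((H.colorClass col j).mult (Multiset.replicate U.card α + X.map Subtype.val) /
            n.choose U.card)) ∧
      -- connectivity of the colour classes
      (∀ j : Fin k,
        (F.colorClass col j).numComponents = (H.colorClass col j).numComponents ↔
          (n : ℤ) - 1 ≤ ((H.colorClass col j).degree α : ℤ) - (H.colorClass col j).numWings α) := by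
  classical
  choose X hX using fun e => MultiHypergraph.exists_eq_replicate_add α (H.ends e)
  let p : E → ℕ := fun e => (H.ends e).count α
  have hp : ∀ e, p e ≤ n := by
    intro e
    by_contra! h
    have := hα (p e) h ((X e).map Subtype.val)
    rw [MultiHypergraph.mult, Finset.card_eq_zero, Finset.filter_eq_empty_iff] at this
    exact this (Finset.mem_univ e) (hX e)
  obtain ⟨A, hA, hdeg, hmult, hlink⟩ := EdgeSplit.exists_even_split n col p X
    (H.colorWing α col) (fun e e' h => congrArg Sigma.fst h) hp
  have hF : (MultiHypergraph.ofSplit A X).IsDetachment H := by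
    intro e
    rw [hX e]
    exact (MultiHypergraph.map_merge_splitEdge (A e) (X e)).trans (by rw [hA])
  have hcount (e : E) (i : Fin n) : ((MultiHypergraph.ofSplit A X).ends e).count (Sum.inr i) =
      if i ∈ A e then 1 else 0 := MultiHypergraph.count_inr_splitEdge _ _ _
  have hendsF (e : E) (U : Finset (Fin n)) (Y : Multiset {v : V // v ≠ α}) :
      (MultiHypergraph.ofSplit A X).ends e = MultiHypergraph.splitEdge U Y ↔ A e = U ∧ X e = Y :=
    MultiHypergraph.splitEdge_inj
  have hendsH (e : E) (t : ℕ) (Y : Multiset {v : V // v ≠ α}) :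
      H.ends e = Multiset.replicate t α + Y.map Subtype.val ↔ p e = t ∧ X e = Y := by
    rw [hX e]
    exact MultiHypergraph.replicate_add_map_val_inj
  refine ⟨MultiHypergraph.ofSplit A X, hF, fun i => ?_, fun i => ?_, fun i j => ?_, fun U Y => ?_,
    fun U Y j => ?_, fun j => ?_⟩
  · refine MultiHypergraph.isSimpleAt_of_count_le_one fun e => ?_
    rw [hcount]
    split_ifs <;> omega
  · have hsel : Finset.univ.filter (EdgeSplit.Sel col none) = Finset.univ := by
      ext e
      simp [EdgeSplit.Sel]
    have h := hdeg i none
    rw [hsel] at h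
    refine h.congr ?_ rfl
    rw [MultiHypergraph.degree, Finset.card_filter]
    simp only [hcount]
  · have hsel : Finset.univ.filter (EdgeSplit.Sel col (some j)) =
        @Finset.filter _ (fun e => col e = j) (fun _ => Classical.propDecidable _) Finset.univ := by
      ext e
      simp [EdgeSplit.Sel]
    have h := hdeg i (some j)
    rw [hsel] at h
    rw [MultiHypergraph.degree_colorClass, MultiHypergraph.degree_colorClass]
    refine h.congr ?_ rfl
    rw [Finset.card_filter]
    simp only [hcount]
  · refine (hmult U Y none).congr (EdgeSplit.card_filter_cast_congr fun e => ?_)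
      (congrArg (fun t : ℝ => t / _) (EdgeSplit.card_filter_cast_congr fun e => ?_))
    · simp [hendsF, EdgeSplit.Sel]
    · simp [hendsH, EdgeSplit.Sel]
  · rw [MultiHypergraph.mult_colorClass, MultiHypergraph.mult_colorClass]
    refine (hmult U Y (some j)).congr (EdgeSplit.card_filter_cast_congr fun e => ?_)
      (congrArg (fun t : ℝ => t / _) (EdgeSplit.card_filter_cast_congr fun e => ?_))
    · simp [hendsF, EdgeSplit.Sel, and_assoc]
    · simp [hendsH, EdgeSplit.Sel, and_assoc]
  · have hFj : ((MultiHypergraph.ofSplit A X).colorClass col j).IsDetachment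
      (H.colorClass col j) := fun e => hF e.1
    have hdegree : (H.colorClass col j).degree α = EdgeSplit.colDeg col p j :=
      MultiHypergraph.degree_colorClass H col j α
    have hwings : (H.colorClass col j).numWings α =
        (EdgeSplit.colWings col p (H.colorWing α col) j).card :=
      MultiHypergraph.numWings_colorClass H α col j
    -- Necessity is the edge count in a connected graph; sufficiency was built into the choice of
    -- `A`.
    have hiff : EdgeSplit.IsLinked col (H.colorWing α col) A j ↔
        n + (EdgeSplit.colWings col p (H.colorWing α col) j).card ≤
          EdgeSplit.colDeg col p j + 1 :=
      ⟨fun h => h.card_le hn hA, hlink j⟩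
    rw [hFj.numComponents_eq_iff hn, ← MultiHypergraph.isLinked_iff_forall_reachable col j hF,
      hwings, hdegree, hiff]
    omega
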